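/- Let $n\ge 1$, write $x=(x_1,\dots,x_n)$, $x_0=t$, $\rho=|\psi|$, and sum over repeated indices $a,b\in\{1,\dots,n\}$; subscripts of functions denote partial derivatives. Let $\mathcal D\subseteq\mathbb R_t\times\mathbb R^n_x\times(0,\infty)_\rho$ be a nonempty open connected set all of whose nonempty sections $t=\mathrm{const}$ are connected, and let $\mathcal T\subseteq\mathbb R$ be its projection to the $t$-axis (an open interval). Let $S\colon\mathcal D\to\mathbb C$ be smooth with $S_\rho\ne 0$, in the sense that $S_\rho$ does not vanish identically on any nonempty open subset of $\mathcal D$. Consider the nonlinear Schrödinger equation $$\mathcal L_S\colon\quad i\psi_t+\psi_{aa}+S(t,x,\rho)\psi=0 .$$ Its maximal Lie invariance algebra $\mathfrak g_S$ is the set of all vector fields $Q=\tau\partial_t+\xi^a\partial_a+\eta\partial_\psi+\eta^*\partial_{\psi^*}$ with smooth real-valued components $\tau,\xi^a$ and smooth complex-valued component $\eta$ (with complex conjugate $\eta^*$), functions of $(t,x,\psi,\psi^*)$ with $(t,x,|\psi|)\in\mathcal D$, that satisfy the infinitesimal invariance criterion $Q_{(2)}\bigl(i\psi_t+\psi_{aa}+S(t,x,\rho)\psi\bigr)\big|_{\mathcal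 L_S}=0$, where $Q_{(2)}$ is the second prolongation of $Q$ to the jet space and the restriction is to the manifold defined by $\mathcal L_S$ in the second-order jet space. Then $\mathfrak g_S$ consists exactly of the vector fields of the form $$Q=D(\tau)-\sum_{a<b}\kappa_{ab}J_{ab}+P(\chi)+\sigma M+\zeta I,$$ where $$D(\tau)=\tau\partial_t+\tfrac12\tau_tx_a\partial_a+\tfrac18\tau_{tt}x_ax_aM,\quad J_{ab}=x_a\partial_b-x_b\partial_a,\quad P(\chi)=\chi^a\partial_a+\tfrac12\chi^a_tx_aM,$$ $$M=i\psi\partial_\psi-i\psi^*\partial_{\psi^*},\quad I=\psi\partial_\psi+\psi^*\partial_{\psi^*},$$ the parameters $\tau,\chi^1,\dots,\chi^n,\sigma,\zeta$ are smooth real-valued functions of $t\in\mathcal T$, and $(\kappa_{ab})$ is a constant real skew-symmetric $n\times n$ matrix, such that together they satisfy the classifying condition $$\tau S_t+\Bigl(\tfrac12\tau_tx_a+\kappa_{ab}x_b+\chi^a\Bigr)S_a+\zeta\rho S_\rho+\tau_tS=\tfrac18\tau_{ttt}x_ax_a+\tfrac12\chi^a_{tt}x_a+\sigma_t-i\zeta_t-i\tfrac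 n4\tau_{tt}$$ at all points $(t,x,\rho)\in\mathcal D$. -/

import Mathlib

open scoped ContDiff

noncomputable section

namespace NLSym

/-- Independent variables `(x_0, x_1, …, x_n)`, where `x_0 = t` is the time. -/
abbrev Base (n : ℕ) := Fin (n + 1) → ℝ

/-- First-order jets `(x, ψ, ψ_μ)`. The conjugate coordinates `ψ*`, `ψ*_μ` are determined by
`ψ`, `ψ_μ`, and all differentiations below are over `ℝ`, so that they act on both. -/
abbrev Jet1 (n : ℕ) := Base n × ℂ × (Fin (n + 1) → ℂ)

/-- Second-order jets `(x, ψ, ψ_μ, ψ_{μν})`; genuine jets have symmetric `ψ_{μν}`. -/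
abbrev Jet2 (n : ℕ) :=
  Base n × ℂ × (Fin (n + 1) → ℂ) × (Fin (n + 1) → Fin (n + 1) → ℂ)

/-- Third-order jets `(x, ψ, ψ_μ, ψ_{μν}, ψ_{μνκ})`; see `Jet3.IsSymm`. -/
abbrev Jet3 (n : ℕ) :=
  Base n × ℂ × (Fin (n + 1) → ℂ) × (Fin (n + 1) → Fin (n + 1) → ℂ) ×
    (Fin (n + 1) → Fin (n + 1) → Fin (n + 1) → ℂ)

variable {n : ℕ}

/-- The derivatives are symmetric in their indices. -/
def Jet3.IsSymm (j : Jet3 n) : Prop :=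
  (∀ μ ν, j.2.2.2.1 μ ν = j.2.2.2.1 ν μ) ∧
  (∀ μ ν l, j.2.2.2.2 μ ν l = j.2.2.2.2 ν μ l) ∧
  (∀ μ ν l, j.2.2.2.2 μ ν l = j.2.2.2.2 μ l ν)

/-- The projection from third-order to second-order jets. -/
def Jet3.toJet2 (j : Jet3 n) : Jet2 n := (j.1, j.2.1, j.2.2.1, j.2.2.2.1)

/-- The total derivative `D_μ F` of a function of first-order jets. -/
def totalDeriv1 (μ : Fin (n + 1)) (F : Jet1 n → ℂ) : Jet2 n → ℂ := fun j =>
  fderiv ℝ F (j.1, j.2.1, j.2.2.1) (Pi.single μ 1, j.2.2.1 μ, j.2.2.2 μ)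

/-- The total derivative `D_μ F` of a function of second-order jets. -/
def totalDeriv2 (μ : Fin (n + 1)) (F : Jet2 n → ℂ) : Jet3 n → ℂ := fun j =>
  fderiv ℝ F j.toJet2 (Pi.single μ 1, j.2.2.1 μ, j.2.2.2.1 μ, j.2.2.2.2 μ)

/-- A vector field `τ ∂_t + ξ^a ∂_a + η ∂_ψ + η* ∂_{ψ*}` on the space of `(t, x, ψ)`, given by its
components: `(Q z).1 0 = τ`, `(Q z).1 a.succ = ξ^a`, `(Q z).2 = η`. -/
abbrev VField (n : ℕ) := Base n × ℂ → Base n × ℂ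

/-- The characteristic `η - τ ψ_t - ξ^a ψ_a` of a vector field. -/
def characteristic (Q : VField n) : Jet1 n → ℂ := fun j =>
  (Q (j.1, j.2.1)).2 - ∑ μ, ((Q (j.1, j.2.1)).1 μ : ℂ) * j.2.2 μ

/-- The component `η^μ` of the prolongation of `Q`. -/
def prolong1 (Q : VField n) (μ : Fin (n + 1)) : Jet2 n → ℂ := fun j =>
  totalDeriv1 μ (characteristic Q) j + ∑ ν, ((Q (j.1, j.2.1)).1 ν : ℂ) * j.2.2.2 μ ν

/-- The component `η^{μν}` of the prolongation of `Q`. It is written on third-order jets, although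
it does not depend on the third derivatives. -/
def prolong2 (Q : VField n) (μ ν : Fin (n + 1)) : Jet3 n → ℂ := fun j =>
  totalDeriv2 μ (totalDeriv1 ν (characteristic Q)) j +
    ∑ l, ((Q (j.1, j.2.1)).1 l : ℂ) * j.2.2.2.2 μ ν l

/-- The second prolongation `Q_(2)`: a tangent vector to the space of second-order jets. -/
def prolong (Q : VField n) (j : Jet3 n) : Jet2 n :=
  ((Q (j.1, j.2.1)).1, (Q (j.1, j.2.1)).2,
    fun μ => prolong1 Q μ j.toJet2, fun μ ν => prolong2 Q μ ν j)

/-- The left-hand side `i ψ_t + ψ_aa + S(t, x, |ψ|) ψ` of the equation, on second-order jets. -/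
def eqnLHS (S : Base n × ℝ → ℂ) : Jet2 n → ℂ := fun j =>
  Complex.I * j.2.2.1 0 + ∑ a : Fin n, j.2.2.2 a.succ a.succ + S (j.1, ‖j.2.1‖) * j.2.1

/-- The partial derivative `S_μ`; `S_0 = S_t`. -/
def dBase (S : Base n × ℝ → ℂ) (μ : Fin (n + 1)) (p : Base n × ℝ) : ℂ :=
  fderiv ℝ S p (Pi.single μ 1, 0)

/-- The partial derivative `S_ρ`. -/
def dRho (S : Base n × ℝ → ℂ) (p : Base n × ℝ) : ℂ := fderiv ℝ S p (0, 1)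

/-- Admissible domains for the arguments `(t, x, ρ)` of `S`: open connected sets in the region
`ρ > 0` all of whose sections `t = const` are connected or empty. -/
structure IsAdmissibleDomain (D : Set (Base n × ℝ)) : Prop where
  isOpen : IsOpen D
  isConnected : IsConnected D
  slice_isPreconnected : ∀ t : ℝ, IsPreconnected {p ∈ D | p.1 0 = t}
  rho_pos : ∀ p ∈ D, 0 < p.2

/-- `S` belongs to the class on the domain `D`: it is smooth, and `S_ρ ≠ 0` in the sense that `S_ρ`
vanishes identically on no nonempty open subset of `D`. -/
structure IsClassS (D : Set (Base n × ℝ)) (S : Base n × ℝ → ℂ) : Prop where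
  smooth : ContDiffOn ℝ ∞ S D
  dRho_ne_zero : D ⊆ closure {p ∈ D | dRho S p ≠ 0}

/-- The set of `(t, x, ψ)` with `(t, x, |ψ|) ∈ D`. -/
def pointSpace (D : Set (Base n × ℝ)) : Set (Base n × ℂ) := {z | (z.1, ‖z.2‖) ∈ D}

/-- The interval of the values of `t` on `D`. -/
def timeSet (D : Set (Base n × ℝ)) : Set ℝ := (fun p => p.1 0) '' D

/-- The maximal Lie invariance algebra of the equation `i ψ_t + ψ_aa + S(t, x, |ψ|) ψ = 0`: the
smooth vector fields whose second prolongation annihilates the left-hand side of the equation on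
the manifold that the equation defines in the jet space. -/
def maximalLieInvarianceAlgebra (D : Set (Base n × ℝ)) (S : Base n × ℝ → ℂ) : Set (VField n) :=
  {Q | ContDiffOn ℝ ∞ Q (pointSpace D) ∧
    ∀ j : Jet3 n, j.IsSymm → (j.1, j.2.1) ∈ pointSpace D → eqnLHS S j.toJet2 = 0 →
      fderiv ℝ (eqnLHS S) j.toJet2 (prolong Q j) = 0}

/-- `M = i ψ ∂_ψ - i ψ* ∂_{ψ*}`. -/
def fieldM : VField n := fun z => (0, Complex.I * z.2)

/-- `I = ψ ∂_ψ + ψ* ∂_{ψ*}`. -/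
def fieldI : VField n := fun z => (0, z.2)

/-- `J_ab = x_a ∂_b - x_b ∂_a`. -/
def fieldJ (a b : Fin n) : VField n := fun z =>
  (Pi.single b.succ (z.1 a.succ) - Pi.single a.succ (z.1 b.succ), 0)

/-- `D(τ) = τ ∂_t + (1/2) τ_t x_a ∂_a + (1/8) τ_tt x_a x_a M`. -/
def fieldD (τ : ℝ → ℝ) : VField n := fun z =>
  (Fin.cons (τ (z.1 0)) (fun a : Fin n => 1 / 2 * deriv τ (z.1 0) * z.1 a.succ), 0) +
    (1 / 8 * iteratedDeriv 2 τ (z.1 0) * ∑ a : Fin n, z.1 a.succ * z.1 a.succ) • fieldM z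

/-- `P(χ) = χ^a ∂_a + (1/2) χ^a_t x_a M`. -/
def fieldP (χ : Fin n → ℝ → ℝ) : VField n := fun z =>
  (Fin.cons 0 (fun a : Fin n => χ a (z.1 0)), 0) +
    (1 / 2 * ∑ a : Fin n, deriv (χ a) (z.1 0) * z.1 a.succ) • fieldM z

/-- `D(τ) - ∑_{a<b} κ_ab J_ab + P(χ) + σ M + ζ I`. -/
def generalField (τ : ℝ → ℝ) (κ : Matrix (Fin n) (Fin n) ℝ) (χ : Fin n → ℝ → ℝ)
    (σ ζ : ℝ → ℝ) : VField n := fun z =>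
  fieldD τ z - ∑ a : Fin n, ∑ b ∈ Finset.Ioi a, κ a b • fieldJ a b z + fieldP χ z
    + σ (z.1 0) • fieldM z + ζ (z.1 0) • fieldI z

/-- The classifying condition at the point `p = (t, x, ρ)`. -/
def ClassifyingCondition (S : Base n × ℝ → ℂ) (τ : ℝ → ℝ) (κ : Matrix (Fin n) (Fin n) ℝ)
    (χ : Fin n → ℝ → ℝ) (σ ζ : ℝ → ℝ) (p : Base n × ℝ) : Prop :=
  let t : ℝ := p.1 0
  let x : Fin n → ℝ := fun a => p.1 a.succ
  let ρ : ℝ := p.2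
  (τ t : ℂ) * dBase S 0 p
      + ∑ a : Fin n,
        ((1 / 2 * deriv τ t * x a + ∑ b : Fin n, κ a b * x b + χ a t : ℝ) : ℂ) * dBase S a.succ p
      + (ζ t : ℂ) * (ρ : ℂ) * dRho S p + ((deriv τ t : ℝ) : ℂ) * S p
    = ((1 / 8 * iteratedDeriv 3 τ t * ∑ a : Fin n, x a * x a
          + 1 / 2 * ∑ a : Fin n, iteratedDeriv 2 (χ a) t * x a + deriv σ t : ℝ) : ℂ)
      - Complex.I * ((deriv ζ t : ℝ) : ℂ) - Complex.I * ((n : ℂ) / 4) * ((iteratedDeriv 2 τ t : ℝ) : ℂ)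

end NLSym

end

/-! The third derivatives of ψ cancel in the second prolongation, so the invariance criterion is an
explicit expression `criterion S Q z p q` in the first and second derivatives p, q of ψ. On the
manifold of the equation these are arbitrary (q symmetric) up to one complex linear relation, so the
criterion splits by varying p, q over a fixed point (t, x, ψ).

The coefficients of ψ_{ta}, of ψ_{ab} with a ≠ b, and of ψ_{aa} (with ψ_t tied to it by the
equation) give `FirstOrderEqs`: τ_a = 0, ξ is independent of ψ, η is holomorphic in ψ, and ξ^a_b +
ξ^b_a = δ_{ab} τ_t. Since the conformal factor τ_t has no x-derivative, all ξ^a_{bc} vanish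
(`snd_space`). The criterion is then a quadratic polynomial in the ψ_a
(`FirstOrderEqs.criterion_eq`), and its coefficients give η_{ψψ} = 0 and 2η_{ψa} = iξ^a_t
(`SecondOrderEqs`). Symmetry of the Hessian of η_ψ makes ξ^a_{tb} symmetric in a, b, so the skew
part κ of the gradient of ξ is constant (`exists_rotation`, by connectedness of D). Integrating in
x, with connected time slices, leaves only functions of t: τ, χ, and σ, ζ from η_ψ
(`exists_normalForm`).

There remains the part of the criterion free of derivatives of ψ. With η = η_ψ ψ + η⁰ it reads Lψ +
C + S_ρ Re(ψ̄η⁰)ψ/|ψ|, where L, C, η⁰ do not change when the phase of ψ turns. Comparing phases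
(`zeroOrder_split`) gives L = 0, which is the classifying condition, and η⁰ = 0 wherever S_ρ ≠ 0,
hence everywhere by density and continuity. Conversely, a field of the normal form satisfies all
determining equations once L = 0. -/

noncomputable section

namespace NLSym

variable {n : ℕ}

/-! ### Calculus on open sets: second derivatives and factorization through a linear functional -/

section Calculus

variable {E F : Type*} [NormedAddCommGroup E] [NormedSpace ℝ E]
  [NormedAddCommGroup F] [NormedSpace ℝ F]

theorem fderiv_apply_eq_of_hasDerivAt {f : E → F} {z v : E} {d : F}
    (hf : DifferentiableAt ℝ f z) (hd : HasDerivAt (fun s : ℝ => f (z + s • v)) d 0) :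
    fderiv ℝ f z v = d :=
  (hf.hasFDerivAt.hasLineDerivAt v).unique hd

theorem differentiableAt_fderiv {U : Set E} (hU : IsOpen U) {f : E → F}
    (hf : ContDiffOn ℝ ∞ f U) {z : E} (hz : z ∈ U) : DifferentiableAt ℝ (fderiv ℝ f) z :=
  ((hf.contDiffAt (hU.mem_nhds hz)).fderiv_right (m := 1) (mod_cast ENat.LEInfty.out)).differentiableAt
      one_ne_zero

/-- A continuous linear condition satisfied by the derivative of a function on an open set passes to
the second derivative. -/
theorem clm_sndDeriv_eq_zero {G : Type*} [NormedAddCommGroup G] [NormedSpace ℝ G]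
    {U : Set E} (hU : IsOpen U) {f : E → F} (hf : ContDiffOn ℝ ∞ f U)
    (L : (E →L[ℝ] F) →L[ℝ] G) (h : ∀ z ∈ U, L (fderiv ℝ f z) = 0) {z : E} (hz : z ∈ U) (u : E) :
    L (fderiv ℝ (fderiv ℝ f) z u) = 0 := by
  have hd := differentiableAt_fderiv hU hf hz
  have h1 : HasFDerivAt (fun z => L (fderiv ℝ f z)) (L.comp (fderiv ℝ (fderiv ℝ f) z)) z :=
    L.hasFDerivAt.comp z hd.hasFDerivAt
  have h2 : HasFDerivAt (fun z => L (fderiv ℝ f z)) (0 : E →L[ℝ] G) z :=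
    (hasFDerivAt_const (0 : G) z).congr_of_eventuallyEq
      (Filter.eventuallyEq_of_mem (hU.mem_nhds hz) h)
  have := congrArg (fun T => T u) (h1.unique h2)
  simpa using this

theorem differentiableAt_of_contDiffOn {U : Set E} (hU : IsOpen U) {f : E → F}
    (hf : ContDiffOn ℝ ∞ f U) {z : E} (hz : z ∈ U) : DifferentiableAt ℝ f z :=
  (hf.contDiffAt (hU.mem_nhds hz)).differentiableAt (by simp)

theorem sndDeriv_comm {U : Set E} (hU : IsOpen U) {f : E → F}
    (hf : ContDiffOn ℝ ∞ f U) {z : E} (hz : z ∈ U) (u v : E) :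
    fderiv ℝ (fderiv ℝ f) z u v = fderiv ℝ (fderiv ℝ f) z v u :=
  ((hf.contDiffAt (hU.mem_nhds hz)).isSymmSndFDerivAt (by simpa using ENat.LEInfty.out)).eq u v

/-- The derivative of a function on an open set in a fixed direction is smooth. -/
theorem contDiffOn_fderiv_apply {U : Set E} (hU : IsOpen U) {f : E → F}
    (hf : ContDiffOn ℝ ∞ f U) (v : E) : ContDiffOn ℝ ∞ (fun z => fderiv ℝ f z v) U :=
  (hf.fderiv_of_isOpen hU (m := ∞) (by simp)).clm_apply contDiffOn_const

theorem fderiv_fderiv_apply {U : Set E} (hU : IsOpen U) {f : E → F}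
    (hf : ContDiffOn ℝ ∞ f U) {z : E} (hz : z ∈ U) (u v : E) :
    fderiv ℝ (fun z => fderiv ℝ f z v) z u = fderiv ℝ (fderiv ℝ f) z u v := by
  rw [((differentiableAt_fderiv hU hf hz).hasFDerivAt.clm_apply (hasFDerivAt_const v z)).fderiv]
  simp

/-- A smooth function on an open set with connected fibres over the line, whose derivative vanishes
along the fibres, is a smooth function of the base point. -/
theorem exists_factorization {U : Set E} (hU : IsOpen U) (l : E →L[ℝ] ℝ) (e : E) (he : l e = 1)
    (hc : ∀ t, IsPreconnected {z ∈ U | l z = t}) {f : E → F} (hf : ContDiffOn ℝ ∞ f U)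
    (h : ∀ z ∈ U, ∀ v, l v = 0 → fderiv ℝ f z v = 0) :
    ∃ φ : ℝ → F, ContDiffOn ℝ ∞ φ (l '' U) ∧ ∀ z ∈ U, f z = φ (l z) := by
  have key : ∀ z ∈ U, ∀ w ∈ U, l z = l w → f z = f w := by
    intro z hz w hw hzw
    refine (hc (l w)).induction₂ (fun a b => f a = f b) ?_ (fun _ _ _ _ _ _ h1 h2 => h1.trans h2)
      (fun _ _ _ _ h => h.symm) ⟨hz, hzw⟩ ⟨hw, rfl⟩
    -- Near `x` the fibre is a ball cut by a hyperplane, hence convex, and `f` is constant along its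
    -- segments; connectedness of the fibre then spreads the equality.
    rintro x ⟨hx, hxt⟩
    obtain ⟨r, hr, hball⟩ := Metric.isOpen_iff.1 hU x hx
    filter_upwards [mem_nhdsWithin_of_mem_nhds (Metric.ball_mem_nhds x hr), self_mem_nhdsWithin]
      with y hy ⟨_, hyt⟩
    have hseg : ∀ s ∈ Set.Icc (0 : ℝ) 1, x + s • (y - x) ∈ U := fun s hs =>
      hball ((convex_ball x r).add_smul_sub_mem (Metric.mem_ball_self hr) hy hs)
    have hder : ∀ s ∈ Set.Icc (0 : ℝ) 1,
        HasDerivAt (fun s : ℝ => f (x + s • (y - x))) 0 s := by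
      intro s hs
      have h1 : HasDerivAt (fun s : ℝ => x + s • (y - x)) (y - x) s := by
        simpa using ((hasDerivAt_id s).smul_const (y - x)).const_add x
      have h2 := (differentiableAt_of_contDiffOn hU hf (hseg s hs)).hasFDerivAt.comp_hasDerivAt s h1
      rwa [h _ (hseg s hs) (y - x) (by simp [hxt, hyt])] at h2
    have := constant_of_has_deriv_right_zero
      (fun s hs => (hder s hs).continuousAt.continuousWithinAt)
      (fun s hs => (hder s (Set.Ico_subset_Icc_self hs)).hasDerivWithinAt) 1 (by simp)
    simpa using this.symm
  classical
  refine ⟨fun t => if h : ∃ z ∈ U, l z = t then f h.choose else 0, ?_, ?_⟩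
  swap
  · intro z hz
    have hex : ∃ w ∈ U, l w = l z := ⟨z, hz, rfl⟩
    simp only [hex, dif_pos]
    exact key _ hz _ hex.choose_spec.1 hex.choose_spec.2.symm
  · rintro _ ⟨z, hz, rfl⟩
    -- Smoothness is local: as `l e = 1`, the line through `z` in direction `e` is a local section
    -- of `l`, along which the new function agrees with `f`.
    have hcont : ContDiff ℝ ∞ (fun t : ℝ => z + (t - l z) • e) := by fun_prop
    have hz' : (fun t : ℝ => z + (t - l z) • e) (l z) = z := by simp
    have hfz : ContDiffAt ℝ ∞ f ((fun t : ℝ => z + (t - l z) • e) (l z)) := by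
      rw [hz']; exact hf.contDiffAt (hU.mem_nhds hz)
    have h1 := hfz.comp (l z) hcont.contDiffAt
    refine (h1.congr_of_eventuallyEq ?_).contDiffWithinAt
    have : ∀ᶠ t in nhds (l z), z + (t - l z) • e ∈ U :=
      hcont.continuous.continuousAt.eventually (by rw [hz']; exact hU.mem_nhds hz)
    filter_upwards [this] with t ht
    have hex : ∃ w ∈ U, l w = t := ⟨_, ht, by simp [he]⟩
    simp only [hex, dif_pos, Function.comp]
    exact key _ hex.choose_spec.1 _ ht (by rw [hex.choose_spec.2]; simp [he])

end Calculus

/-! ### Topology of the domain and rotations of ψ -/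

section Domain

variable {D : Set (Base n × ℝ)}

theorem IsAdmissibleDomain.isOpen_pointSpace (hD : IsAdmissibleDomain D) :
    IsOpen (pointSpace D) :=
  hD.isOpen.preimage (by fun_prop : Continuous fun z : Base n × ℂ => (z.1, ‖z.2‖))

/-- The part of `pointSpace D` over a part of `D` is swept out by rotations in `ψ`. -/
theorem isPreconnected_rotations {D' : Set (Base n × ℝ)} (hc : IsPreconnected D')
    (hpos : ∀ p ∈ D', 0 < p.2) : IsPreconnected {z : Base n × ℂ | (z.1, ‖z.2‖) ∈ D'} := by
  have hcont : Continuous fun q : (Base n × ℝ) × ℝ =>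
      ((q.1.1, (q.1.2 : ℂ) * Complex.exp (q.2 * Complex.I)) : Base n × ℂ) := by fun_prop
  have := (hc.prod (isPreconnected_univ (α := ℝ))).image _ hcont.continuousOn
  convert this using 1
  ext z
  constructor
  · intro hz
    exact ⟨((z.1, ‖z.2‖), Complex.arg z.2), ⟨hz, trivial⟩,
      Prod.ext rfl (Complex.norm_mul_exp_arg_mul_I z.2)⟩
  · rintro ⟨⟨p, θ⟩, ⟨hp, -⟩, rfl⟩
    have : ‖(p.2 : ℂ) * Complex.exp (θ * Complex.I)‖ = p.2 := by
      rw [norm_mul, Complex.norm_exp_ofReal_mul_I, mul_one, Complex.norm_real,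
        Real.norm_of_nonneg (hpos p hp).le]
    rw [Set.mem_ofPred_eq, this]
    exact hp

theorem IsAdmissibleDomain.isPreconnected_pointSpace (hD : IsAdmissibleDomain D) :
    IsPreconnected (pointSpace D) :=
  isPreconnected_rotations hD.isConnected.isPreconnected hD.rho_pos

/-- The time coordinate on the space of `(t, x, ψ)`. -/
def timeCLM (n : ℕ) : Base n × ℂ →L[ℝ] ℝ :=
  (ContinuousLinearMap.proj 0).comp (ContinuousLinearMap.fst ℝ (Base n) ℂ)

@[simp] theorem timeCLM_apply (z : Base n × ℂ) : timeCLM n z = z.1 0 := rfl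

theorem IsAdmissibleDomain.isPreconnected_slice (hD : IsAdmissibleDomain D) (t : ℝ) :
    IsPreconnected {z ∈ pointSpace D | timeCLM n z = t} :=
  isPreconnected_rotations (hD.slice_isPreconnected t) fun p hp => hD.rho_pos p hp.1

theorem IsAdmissibleDomain.ne_zero (hD : IsAdmissibleDomain D) {z : Base n × ℂ}
    (hz : z ∈ pointSpace D) : z.2 ≠ 0 :=
  norm_pos_iff.1 (hD.rho_pos _ hz)

theorem IsAdmissibleDomain.ofReal_mem (hD : IsAdmissibleDomain D) {p : Base n × ℝ}
    (hp : p ∈ D) : ((p.1, (p.2 : ℂ)) : Base n × ℂ) ∈ pointSpace D := by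
  simpa [pointSpace, abs_of_pos (hD.rho_pos p hp)] using hp

theorem IsAdmissibleDomain.image_timeCLM (hD : IsAdmissibleDomain D) :
    timeCLM n '' pointSpace D = timeSet D := by
  ext t
  constructor
  · rintro ⟨z, hz, rfl⟩; exact ⟨_, hz, rfl⟩
  · rintro ⟨p, hp, rfl⟩; exact ⟨_, hD.ofReal_mem hp, rfl⟩

theorem mem_timeSet {z : Base n × ℂ} (hz : z ∈ pointSpace D) : z.1 0 ∈ timeSet D := ⟨_, hz, rfl⟩

theorem IsAdmissibleDomain.isOpen_timeSet (hD : IsAdmissibleDomain D) : IsOpen (timeSet D) := by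
  rw [← hD.image_timeCLM]
  refine (ContinuousLinearMap.isOpenMap (timeCLM n) fun t => ?_) _ hD.isOpen_pointSpace
  exact ⟨(Pi.single 0 t, 0), by simp⟩

theorem clm_apply_eq_sum {F : Type*} [NormedAddCommGroup F] [NormedSpace ℝ F]
    (T : Base n × ℂ →L[ℝ] F) (v : Base n) (w : ℂ) :
    T (v, w) = v 0 • T (Pi.single 0 1, 0) + ∑ a : Fin n, v a.succ • T (Pi.single a.succ 1, 0)
      + T (0, w) := by
  have hv : ((v, w) : Base n × ℂ) = (v 0 : ℝ) • ((Pi.single 0 1, 0) : Base n × ℂ)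
      + ∑ a : Fin n, v a.succ • ((Pi.single a.succ 1, 0) : Base n × ℂ) + (0, w) := by
    ext i
    · rw [show ((v, w) : Base n × ℂ).1 i = (∑ j, v j • (Pi.single j 1 : Base n)) i by
        rw [Finset.sum_apply]; simp [Pi.single_apply], Fin.sum_univ_succ]
      simp [Prod.fst_sum]
    · simp [Prod.snd_sum]
  rw [hv, map_add, map_add, map_sum]
  simp only [map_smul]

theorem IsAdmissibleDomain.exists_factorization {F : Type*} [NormedAddCommGroup F]
    [NormedSpace ℝ F] (hD : IsAdmissibleDomain D) {f : Base n × ℂ → F}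
    (hf : ContDiffOn ℝ ∞ f (pointSpace D))
    (hx : ∀ z ∈ pointSpace D, ∀ a : Fin n, fderiv ℝ f z (Pi.single a.succ 1, 0) = 0)
    (hψ : ∀ z ∈ pointSpace D, ∀ w : ℂ, fderiv ℝ f z (0, w) = 0) :
    ∃ φ : ℝ → F, ContDiffOn ℝ ∞ φ (timeSet D) ∧ ∀ z ∈ pointSpace D, f z = φ (z.1 0) := by
  rw [← hD.image_timeCLM]
  refine NLSym.exists_factorization hD.isOpen_pointSpace (timeCLM n) (Pi.single 0 1, 0) (by simp)
    hD.isPreconnected_slice hf ?_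
  rintro z hz ⟨v, w⟩ hv
  simp only [timeCLM_apply] at hv
  rw [clm_apply_eq_sum]
  simp only [hv, hx z hz, hψ z hz, smul_zero, zero_smul, Finset.sum_const_zero,
    add_zero]

/-- A function whose derivatives in `ψ` vanish is invariant under the rotations in `ψ`. -/
theorem IsAdmissibleDomain.rotation_invariant {F : Type*} [NormedAddCommGroup F]
    [NormedSpace ℝ F] (hD : IsAdmissibleDomain D) {f : Base n × ℂ → F}
    (hf : ContDiffOn ℝ ∞ f (pointSpace D))
    (hψ : ∀ z ∈ pointSpace D, ∀ w : ℂ, fderiv ℝ f z (0, w) = 0) {z : Base n × ℂ}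
    (hz : z ∈ pointSpace D) {c : ℂ} (hc : ‖c‖ = 1) : f (z.1, c * z.2) = f z := by
  have hmem : ∀ θ : ℝ, ((z.1, Complex.exp (θ * Complex.I) * z.2) : Base n × ℂ) ∈ pointSpace D := by
    intro θ
    have : ‖Complex.exp (θ * Complex.I) * z.2‖ = ‖z.2‖ := by
      rw [norm_mul, Complex.norm_exp_ofReal_mul_I, one_mul]
    simpa only [pointSpace, Set.mem_ofPred_eq, this] using hz
  have hder : ∀ θ : ℝ, HasDerivAt
      (fun θ : ℝ => f (z.1, Complex.exp (θ * Complex.I) * z.2)) 0 θ := by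
    intro θ
    have h1 : HasDerivAt (fun θ : ℝ => Complex.exp (θ * Complex.I) * z.2)
        (Complex.exp (θ * Complex.I) * (1 * Complex.I) * z.2) θ :=
      (((Complex.ofRealCLM.hasDerivAt (x := θ)).mul_const Complex.I).cexp).mul_const z.2
    have h2 := (hasDerivAt_const θ z.1).prodMk h1
    have h3 := (differentiableAt_of_contDiffOn hD.isOpen_pointSpace hf
      (hmem θ)).hasFDerivAt.comp_hasDerivAt θ h2
    rwa [hψ _ (hmem θ)] at h3
  have := is_const_of_deriv_eq_zero (fun θ => (hder θ).differentiableAt)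
    (fun θ => (hder θ).deriv) (Complex.arg c) 0
  have hc' : Complex.exp (Complex.arg c * Complex.I) = c := by
    have := Complex.norm_mul_exp_arg_mul_I c
    rwa [hc, Complex.ofReal_one, one_mul] at this
  simpa [hc'] using this

/-- Second derivatives commute, so base derivatives of a function with vanishing ψ-derivative
inherit that property. Only invariance under rotations follows: the values of ρ admitted over a
given (t, x) may form a disconnected set, while each circle |ψ| = ρ is connected. -/
theorem fderiv_rotation_invariant {F : Type*} [NormedAddCommGroup F]
    [NormedSpace ℝ F] (hD : IsAdmissibleDomain D) {f : Base n × ℂ → F}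
    (hf : ContDiffOn ℝ ∞ f (pointSpace D))
    (hψ : ∀ z ∈ pointSpace D, ∀ w : ℂ, fderiv ℝ f z (0, w) = 0) {z : Base n × ℂ}
    (hz : z ∈ pointSpace D) {c : ℂ} (hc : ‖c‖ = 1) (v : Base n) :
    fderiv ℝ f (z.1, c * z.2) (v, 0) = fderiv ℝ f z (v, 0) := by
  refine IsAdmissibleDomain.rotation_invariant hD (f := fun z => fderiv ℝ f z (v, 0))
    (contDiffOn_fderiv_apply hD.isOpen_pointSpace hf _) ?_ hz hc
  intro z hz w
  rw [fderiv_fderiv_apply hD.isOpen_pointSpace hf hz, sndDeriv_comm hD.isOpen_pointSpace hf hz]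
  exact clm_sndDeriv_eq_zero hD.isOpen_pointSpace hf
    (ContinuousLinearMap.apply ℝ F ((0, w) : Base n × ℂ)) (fun z hz => hψ z hz w) hz _

end Domain

/-! ### Explicit second prolongation -/

section Prolongation

variable {D : Set (Base n × ℝ)}

/-- The component along `x_l` of a vector, as a complex number. -/
def baseCLM (l : Fin (n + 1)) : Base n × ℂ →L[ℝ] ℂ :=
  Complex.ofRealCLM.comp
    ((ContinuousLinearMap.proj l).comp (ContinuousLinearMap.fst ℝ (Base n) ℂ))

theorem baseCLM_apply (l : Fin (n + 1)) (z : Base n × ℂ) : baseCLM l z = (z.1 l : ℂ) := rfl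

theorem totalDeriv1_characteristic {U : Set (Base n × ℂ)} (hU : IsOpen U) {Q : VField n}
    (hQ : ContDiffOn ℝ ∞ Q U) (ν : Fin (n + 1)) (j : Jet2 n) (hj : (j.1, j.2.1) ∈ U) :
    totalDeriv1 ν (characteristic Q) j =
      (fderiv ℝ Q (j.1, j.2.1) (Pi.single ν 1, j.2.2.1 ν)).2 -
        ∑ l, (baseCLM l (fderiv ℝ Q (j.1, j.2.1) (Pi.single ν 1, j.2.2.1 ν)) * j.2.2.1 l +
          baseCLM l (Q (j.1, j.2.1)) * j.2.2.2 ν l) := by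
  have hd := differentiableAt_of_contDiffOn hU hQ hj
  have hπ : HasFDerivAt (fun i : Jet1 n => Q (i.1, i.2.1)) _ (j.1, j.2.1, j.2.2.1) :=
    HasFDerivAt.comp (f := fun i : Jet1 n => (i.1, i.2.1)) (j.1, j.2.1, j.2.2.1) hd.hasFDerivAt
      (((ContinuousLinearMap.fst ℝ (Base n) (ℂ × (Fin (n + 1) → ℂ)))).prod
        ((ContinuousLinearMap.fst ℝ ℂ (Fin (n + 1) → ℂ)).comp
          (ContinuousLinearMap.snd ℝ (Base n) (ℂ × (Fin (n + 1) → ℂ))))).hasFDerivAt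
  have hp : ∀ l, HasFDerivAt (fun i : Jet1 n => i.2.2 l) _ (j.1, j.2.1, j.2.2.1) := fun l =>
    ((ContinuousLinearMap.proj (R := ℝ) (φ := fun _ : Fin (n + 1) => ℂ) l).comp
      ((ContinuousLinearMap.snd ℝ ℂ (Fin (n + 1) → ℂ)).comp
        (ContinuousLinearMap.snd ℝ (Base n) (ℂ × (Fin (n + 1) → ℂ))))).hasFDerivAt
  have h1 := (((ContinuousLinearMap.snd ℝ (Base n) ℂ).hasFDerivAt.comp _ hπ).sub
    (HasFDerivAt.fun_sum (u := Finset.univ) fun l _ =>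
      ((baseCLM l).hasFDerivAt.comp _ hπ).mul (hp l)))
  have h2 : HasFDerivAt (characteristic Q) _ (j.1, j.2.1, j.2.2.1) := h1
  rw [totalDeriv1, h2.fderiv]
  simp only [_root_.sub_apply, ContinuousLinearMap.comp_apply,
    _root_.sum_apply, _root_.add_apply, _root_.smul_apply,
    ContinuousLinearMap.prod_apply, ContinuousLinearMap.coe_fst', ContinuousLinearMap.coe_snd',
    ContinuousLinearMap.proj_apply, Function.comp_apply, smul_eq_mul]
  congr 1
  exact Finset.sum_congr rfl fun l _ => by ring

/-- The third derivatives occur only in the last term of the sum, which is exactly what `prolong2`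
adds back. -/
theorem totalDeriv2_characteristic {U : Set (Base n × ℂ)} (hU : IsOpen U) {Q : VField n}
    (hQ : ContDiffOn ℝ ∞ Q U) (μ ν : Fin (n + 1)) (j : Jet3 n) (hj : (j.1, j.2.1) ∈ U) :
    totalDeriv2 μ (totalDeriv1 ν (characteristic Q)) j =
      (fderiv ℝ (fderiv ℝ Q) (j.1, j.2.1) (Pi.single μ 1, j.2.2.1 μ) (Pi.single ν 1, j.2.2.1 ν)
        + fderiv ℝ Q (j.1, j.2.1) (0, j.2.2.2.1 μ ν)).2 -
        ∑ l, (baseCLM l (fderiv ℝ (fderiv ℝ Q) (j.1, j.2.1) (Pi.single μ 1, j.2.2.1 μ)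
            (Pi.single ν 1, j.2.2.1 ν) + fderiv ℝ Q (j.1, j.2.1) (0, j.2.2.2.1 μ ν)) * j.2.2.1 l +
          baseCLM l (fderiv ℝ Q (j.1, j.2.1) (Pi.single ν 1, j.2.2.1 ν)) * j.2.2.2.1 μ l +
          baseCLM l (fderiv ℝ Q (j.1, j.2.1) (Pi.single μ 1, j.2.2.1 μ)) * j.2.2.2.1 ν l +
          baseCLM l (Q (j.1, j.2.1)) * j.2.2.2.2 μ ν l) := by
  let V1 := Fin (n + 1) → ℂ
  let V2 := Fin (n + 1) → Fin (n + 1) → ℂ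
  let S1 : Jet2 n →L[ℝ] (ℂ × V1 × V2) := ContinuousLinearMap.snd ℝ (Base n) (ℂ × V1 × V2)
  let S2 : Jet2 n →L[ℝ] (V1 × V2) := (ContinuousLinearMap.snd ℝ ℂ (V1 × V2)).comp S1
  let π0 : Jet2 n →L[ℝ] Base n × ℂ := (ContinuousLinearMap.fst ℝ (Base n) (ℂ × V1 × V2)).prod
    ((ContinuousLinearMap.fst ℝ ℂ (V1 × V2)).comp S1)
  let π1 : Fin (n + 1) → Jet2 n →L[ℝ] ℂ := fun l =>
    (ContinuousLinearMap.proj (R := ℝ) (φ := fun _ : Fin (n + 1) => ℂ) l).comp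
      ((ContinuousLinearMap.fst ℝ V1 V2).comp S2)
  let π2 : Fin (n + 1) → Jet2 n →L[ℝ] ℂ := fun l =>
    (ContinuousLinearMap.proj (R := ℝ) (φ := fun _ : Fin (n + 1) => ℂ) l).comp
      ((ContinuousLinearMap.proj (R := ℝ) (φ := fun _ : Fin (n + 1) => Fin (n + 1) → ℂ) ν).comp
      ((ContinuousLinearMap.snd ℝ V1 V2).comp S2))
  have hd := differentiableAt_of_contDiffOn hU hQ hj
  have hdd := differentiableAt_fderiv hU hQ hj
  have hQ' : HasFDerivAt (fun i : Jet2 n => Q (π0 i)) _ j.toJet2 :=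
    HasFDerivAt.comp (f := fun i : Jet2 n => π0 i) j.toJet2 hd.hasFDerivAt π0.hasFDerivAt
  have hA : HasFDerivAt (fun i : Jet2 n => fderiv ℝ Q (π0 i)) _ j.toJet2 :=
    HasFDerivAt.comp (f := fun i : Jet2 n => π0 i) j.toJet2 hdd.hasFDerivAt π0.hasFDerivAt
  have hA' := hA.clm_apply ((hasFDerivAt_const (Pi.single ν 1 : Base n) j.toJet2).prodMk
    (π1 ν).hasFDerivAt)
  have h1 := (((ContinuousLinearMap.snd ℝ (Base n) ℂ).hasFDerivAt.comp _ hA').sub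
    (HasFDerivAt.fun_sum (u := Finset.univ) fun l _ =>
      (((baseCLM l).hasFDerivAt.comp _ hA').mul (π1 l).hasFDerivAt).add
        (((baseCLM l).hasFDerivAt.comp _ hQ').mul (π2 l).hasFDerivAt)))
  have hev : totalDeriv1 ν (characteristic Q) =ᶠ[nhds j.toJet2] _ :=
    Filter.eventuallyEq_of_mem ((hU.preimage π0.continuous).mem_nhds hj)
      fun i hi => totalDeriv1_characteristic hU hQ ν i hi
  have h2 := HasFDerivAt.congr_of_eventuallyEq h1 hev
  rw [totalDeriv2, h2.fderiv]
  simp only [_root_.sub_apply, ContinuousLinearMap.comp_apply,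
    _root_.sum_apply, _root_.add_apply, _root_.smul_apply,
    ContinuousLinearMap.prod_apply, ContinuousLinearMap.coe_fst', ContinuousLinearMap.coe_snd',
    ContinuousLinearMap.proj_apply, Function.comp_apply, smul_eq_mul,
    ContinuousLinearMap.flip_apply, π0, π1, π2, S1, S2, Jet3.toJet2, _root_.zero_apply]
  congr 1
  · rw [add_comm]
  · refine Finset.sum_congr rfl fun l _ => ?_
    simp only [map_add]
    ring

/-- The infinitesimal invariance criterion at the jet `(z, p, q)`. -/
def criterion (S : Base n × ℝ → ℂ) (Q : VField n) (z : Base n × ℂ) (p : Fin (n + 1) → ℂ)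
    (q : Fin (n + 1) → Fin (n + 1) → ℂ) : ℂ :=
  Complex.I * ((fderiv ℝ Q z (Pi.single 0 1, p 0)).2 -
      ∑ l, baseCLM l (fderiv ℝ Q z (Pi.single 0 1, p 0)) * p l) +
    ∑ a : Fin n,
      ((fderiv ℝ (fderiv ℝ Q) z (Pi.single a.succ 1, p a.succ) (Pi.single a.succ 1, p a.succ)
          + fderiv ℝ Q z (0, q a.succ a.succ)).2 -
        ∑ l, (baseCLM l (fderiv ℝ (fderiv ℝ Q) z (Pi.single a.succ 1, p a.succ)
            (Pi.single a.succ 1, p a.succ) + fderiv ℝ Q z (0, q a.succ a.succ)) * p l +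
          2 * baseCLM l (fderiv ℝ Q z (Pi.single a.succ 1, p a.succ)) * q a.succ l)) +
    (fderiv ℝ S (z.1, ‖z.2‖) ((Q z).1, inner ℝ z.2 (Q z).2 / ‖z.2‖) * z.2 +
      S (z.1, ‖z.2‖) * (Q z).2)

theorem hasFDerivAt_norm_complex {w : ℂ} (hw : w ≠ 0) :
    HasFDerivAt (fun w : ℂ => ‖w‖) ((‖w‖⁻¹ : ℝ) • innerSL ℝ w) w := by
  have h := ((hasStrictFDerivAt_norm_sq w).hasFDerivAt).sqrt (by positivity)
  simp only [Real.sqrt_sq (norm_nonneg _)] at h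
  rw [← Nat.cast_smul_eq_nsmul ℝ, smul_smul] at h
  have hw' : ‖w‖ ≠ 0 := norm_ne_zero_iff.2 hw
  rwa [show 1 / (2 * ‖w‖) * ((2 : ℕ) : ℝ) = ‖w‖⁻¹ by push_cast; field_simp] at h

/-- The highest-order terms of the characteristic cancel against the corrections in `prolong1` and
`prolong2`. The modulus is differentiable because ψ ≠ 0 over D, and its derivative along η is
Re(ψ̄η)/|ψ|. -/
theorem fderiv_eqnLHS_prolong (hD : IsAdmissibleDomain D) {S : Base n × ℝ → ℂ}
    (hS : IsClassS D S) {Q : VField n} (hQ : ContDiffOn ℝ ∞ Q (pointSpace D)) (j : Jet3 n)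
    (hj : (j.1, j.2.1) ∈ pointSpace D) :
    fderiv ℝ (eqnLHS S) j.toJet2 (prolong Q j) =
      criterion S Q (j.1, j.2.1) j.2.2.1 j.2.2.2.1 := by
  let V1 := Fin (n + 1) → ℂ
  let V2 := Fin (n + 1) → Fin (n + 1) → ℂ
  let S1 : Jet2 n →L[ℝ] (ℂ × V1 × V2) := ContinuousLinearMap.snd ℝ (Base n) (ℂ × V1 × V2)
  let S2 : Jet2 n →L[ℝ] (V1 × V2) := (ContinuousLinearMap.snd ℝ ℂ (V1 × V2)).comp S1
  let πx : Jet2 n →L[ℝ] Base n := ContinuousLinearMap.fst ℝ (Base n) (ℂ × V1 × V2)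
  let πψ : Jet2 n →L[ℝ] ℂ := (ContinuousLinearMap.fst ℝ ℂ (V1 × V2)).comp S1
  let π1 : Jet2 n →L[ℝ] ℂ :=
    (ContinuousLinearMap.proj (R := ℝ) (φ := fun _ : Fin (n + 1) => ℂ) 0).comp
      ((ContinuousLinearMap.fst ℝ V1 V2).comp S2)
  let π2 : Fin n → Jet2 n →L[ℝ] ℂ := fun a =>
    (ContinuousLinearMap.proj (R := ℝ) (φ := fun _ : Fin (n + 1) => ℂ) a.succ).comp
      ((ContinuousLinearMap.proj (R := ℝ) (φ := fun _ : Fin (n + 1) => Fin (n + 1) → ℂ)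
        a.succ).comp ((ContinuousLinearMap.snd ℝ V1 V2).comp S2))
  have hψ : j.2.1 ≠ 0 := hD.ne_zero hj
  have hSd : DifferentiableAt ℝ S (j.1, ‖j.2.1‖) :=
    differentiableAt_of_contDiffOn hD.isOpen hS.smooth hj
  have hnorm : HasFDerivAt (fun i : Jet2 n => ‖πψ i‖) _ j.toJet2 :=
    HasFDerivAt.comp (f := fun i : Jet2 n => πψ i) j.toJet2 (hasFDerivAt_norm_complex hψ)
      πψ.hasFDerivAt
  have hS' : HasFDerivAt (fun i : Jet2 n => S (πx i, ‖πψ i‖)) _ j.toJet2 :=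
    HasFDerivAt.comp (f := fun i : Jet2 n => (πx i, ‖πψ i‖)) j.toJet2 hSd.hasFDerivAt
      (πx.hasFDerivAt.prodMk hnorm)
  have h1 : HasFDerivAt (eqnLHS S) _ j.toJet2 :=
    ((π1.hasFDerivAt.const_mul Complex.I).add
      (HasFDerivAt.fun_sum (u := Finset.univ) fun a _ => (π2 a).hasFDerivAt)).add
        (hS'.mul πψ.hasFDerivAt)
  rw [h1.fderiv]
  simp only [ContinuousLinearMap.comp_apply,
    _root_.sum_apply, _root_.add_apply, _root_.smul_apply,
    ContinuousLinearMap.prod_apply, ContinuousLinearMap.coe_fst', ContinuousLinearMap.coe_snd',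
    ContinuousLinearMap.proj_apply, smul_eq_mul, πx, πψ, π1, π2, S1, S2, prolong, prolong1,
    prolong2, innerSL_apply_apply]
  rw [criterion]
  congr 1
  · congr 1
    · congr 1
      rw [totalDeriv1_characteristic hD.isOpen_pointSpace hQ 0 j.toJet2 hj]
      simp only [Finset.sum_add_distrib, Jet3.toJet2, baseCLM_apply]
      ring
    · refine Finset.sum_congr rfl fun a _ => ?_
      rw [totalDeriv2_characteristic hD.isOpen_pointSpace hQ _ _ j hj]
      simp only [mul_assoc, Finset.sum_add_distrib, ← Finset.mul_sum, baseCLM_apply]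
      ring
  · rw [add_comm]
    simp only [Jet3.toJet2]
    congr 1
    rw [mul_comm, div_eq_inv_mul]

end Prolongation

/-! ### Splitting the criterion into determining equations -/

section DeterminingEquations

variable {D : Set (Base n × ℝ)}

/-- The criterion holds at all jets over `z` that satisfy the equation. -/
def CriterionAt (S : Base n × ℝ → ℂ) (Q : VField n) (z : Base n × ℂ) : Prop :=
  ∀ (p : Fin (n + 1) → ℂ) (q : Fin (n + 1) → Fin (n + 1) → ℂ), (∀ μ ν, q μ ν = q ν μ) →
    Complex.I * p 0 + ∑ a : Fin n, q a.succ a.succ + S (z.1, ‖z.2‖) * z.2 = 0 →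
    criterion S Q z p q = 0

theorem mem_maximalLieInvarianceAlgebra_iff (hD : IsAdmissibleDomain D) {S : Base n × ℝ → ℂ}
    (hS : IsClassS D S) {Q : VField n} :
    Q ∈ maximalLieInvarianceAlgebra D S ↔
      ContDiffOn ℝ ∞ Q (pointSpace D) ∧ ∀ z ∈ pointSpace D, CriterionAt S Q z := by
  refine and_congr_right fun hQ => ⟨fun h z hz p q hq he => ?_, fun h j hj hz he => ?_⟩
  -- Third derivatives do not enter the criterion, so any symmetric choice serves; zero is the
  -- simplest.
  · have := h (z.1, z.2, p, q, 0) ⟨hq, fun _ _ _ => rfl, fun _ _ _ => rfl⟩ hz he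
    rwa [fderiv_eqnLHS_prolong hD hS hQ _ hz] at this
  · rw [fderiv_eqnLHS_prolong hD hS hQ _ hz]
    exact h _ hz _ _ hj.1 he

theorem criterion_sub (S : Base n × ℝ → ℂ) (Q : VField n) (z : Base n × ℂ) (p : Fin (n + 1) → ℂ)
    (q : Fin (n + 1) → Fin (n + 1) → ℂ) (hq : ∀ a : Fin n, q a.succ a.succ = 0) :
    criterion S Q z p q - criterion S Q z p 0 =
      -2 * ∑ a : Fin n, ∑ l, baseCLM l (fderiv ℝ Q z (Pi.single a.succ 1, p a.succ)) *
        q a.succ l := by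
  simp only [criterion, hq, Pi.zero_apply, mul_zero, add_zero, Finset.sum_add_distrib,
    Finset.sum_sub_distrib, mul_assoc, ← Finset.mul_sum]
  ring

section Pointwise

variable {S : Base n × ℝ → ℂ} {Q : VField n} {z : Base n × ℂ}

/-- The equation sees only the spatial diagonal ψ_{aa}. A change of the other second derivatives
therefore stays on its manifold, and the terms 2(D_a ξ^l)ψ_{al} that feel the change must vanish on
their own. -/
theorem CriterionAt.sum_eq_zero (h : CriterionAt S Q z) (r : Fin n → ℂ)
    (q : Fin (n + 1) → Fin (n + 1) → ℂ) (hq : ∀ a : Fin n, q a.succ a.succ = 0)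
    (hs : ∀ μ ν, q μ ν = q ν μ) :
    ∑ a : Fin n, ∑ l, baseCLM l (fderiv ℝ Q z (Pi.single a.succ 1, r a)) * q a.succ l = 0 := by
  -- This value of ψ_t solves the equation when all ψ_{aa} vanish.
  let p : Fin (n + 1) → ℂ := Fin.cons (Complex.I * (S (z.1, ‖z.2‖) * z.2)) r
  have hp : Complex.I * p 0 + S (z.1, ‖z.2‖) * z.2 = 0 := by
    simp [p, ← mul_assoc]
  have h1 := h p q hs (by simpa [hq] using hp)
  have h2 := h p 0 (fun _ _ => rfl) (by simpa using hp)
  have h3 := criterion_sub S Q z p q hq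
  rw [h1, h2] at h3
  simpa [p] using h3

/-- Coefficient of ψ_{ta}. Here ψ_a = w is still free, so the x- and ψ-derivatives of τ are covered
together. -/
theorem CriterionAt.time_eq_zero (h : CriterionAt S Q z) (a : Fin n) (w : ℂ) :
    baseCLM 0 (fderiv ℝ Q z (Pi.single a.succ 1, w)) = 0 := by
  have := h.sum_eq_zero (fun _ => w)
    (fun μ ν => (if μ = a.succ then if ν = 0 then 1 else 0 else 0) +
      (if ν = a.succ then if μ = 0 then 1 else 0 else 0)) (by simp)
    (fun μ ν => add_comm _ _)
  simpa [mul_ite, Finset.sum_ite_eq, Finset.sum_add_distrib, mul_add] using this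

theorem CriterionAt.time_psi_eq_zero (hn : 1 ≤ n) (h : CriterionAt S Q z) (w : ℂ) :
    baseCLM 0 (fderiv ℝ Q z (0, w)) = 0 := by
  have h1 := h.time_eq_zero ⟨0, hn⟩ w
  have h2 := h.time_eq_zero ⟨0, hn⟩ 0
  rw [show ((0, w) : Base n × ℂ) = (Pi.single (Fin.succ ⟨0, hn⟩) 1, w) -
    (Pi.single (Fin.succ ⟨0, hn⟩) 1, 0) by simp, map_sub, map_sub, h1, h2, sub_zero]

theorem CriterionAt.killing_offdiag (h : CriterionAt S Q z) {a b : Fin n} (hab : a ≠ b) :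
    baseCLM b.succ (fderiv ℝ Q z (Pi.single a.succ 1, 0)) +
      baseCLM a.succ (fderiv ℝ Q z (Pi.single b.succ 1, 0)) = 0 := by
  have := h.sum_eq_zero (fun _ => 0)
    (fun μ ν => (if μ = a.succ then if ν = b.succ then 1 else 0 else 0) +
      (if ν = a.succ then if μ = b.succ then 1 else 0 else 0))
    (fun c => by
      by_cases hc : c = a
      · simp [hc, hab]
      · simp [hc])
    (fun μ ν => add_comm _ _)
  simpa [mul_ite, Finset.sum_ite_eq, Finset.sum_add_distrib, mul_add] using this

theorem clm_apply_split {F : Type*} [NormedAddCommGroup F] [NormedSpace ℝ F]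
    (T : Base n × ℂ →L[ℝ] F) (v : Base n) (w : ℂ) : T (v, w) = T (v, 0) + T (0, w) := by
  rw [← map_add]; simp

/-- Raising ψ_{aa} by w forces ψ_t up by iw. The identity is the difference of the criterion at the
two jets, with ψ_a = v and the other spatial first derivatives zero. -/
theorem CriterionAt.diag (h : CriterionAt S Q z)
    (h1 : ∀ w, baseCLM 0 (fderiv ℝ Q z (0, w)) = 0)
    (h2 : ∀ (u : Base n × ℂ) (a : Fin n) (w : ℂ),
      baseCLM 0 (fderiv ℝ (fderiv ℝ Q) z u (Pi.single a.succ 1, w)) = 0) (a : Fin n) (v w : ℂ) :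
    Complex.I * ((fderiv ℝ Q z (0, Complex.I * w)).2 -
        baseCLM 0 (fderiv ℝ Q z (Pi.single 0 1, 0)) * (Complex.I * w) -
        baseCLM a.succ (fderiv ℝ Q z (0, Complex.I * w)) * v) +
      (fderiv ℝ Q z (0, w)).2 - baseCLM a.succ (fderiv ℝ Q z (0, w)) * v -
      2 * baseCLM a.succ (fderiv ℝ Q z (Pi.single a.succ 1, v)) * w = 0 := by
  let r : Fin n → ℂ := Pi.single a v
  let c := Complex.I * (S (z.1, ‖z.2‖) * z.2)
  have e1 := h (Fin.cons (c + Complex.I * w) r)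
    (fun μ ν => if μ = ν then if μ = a.succ then w else 0 else 0)
    (fun μ ν => by by_cases hμ : μ = ν <;> simp [hμ, eq_comm])
    (by simp [c, mul_add, ← mul_assoc])
  have e2 := h (Fin.cons c r) 0 (fun _ _ => rfl) (by simp [c, ← mul_assoc])
  have hz : ∀ w, fderiv ℝ Q z (Pi.single 0 1, c + w) =
      fderiv ℝ Q z (Pi.single 0 1, c) + fderiv ℝ Q z (0, w) := fun w => by
    rw [← map_add]; simp
  have e3 : baseCLM 0 (fderiv ℝ Q z (Pi.single 0 1, c)) =
      baseCLM 0 (fderiv ℝ Q z (Pi.single 0 1, 0)) := by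
    rw [clm_apply_split _ _ c, map_add, h1, add_zero]
  refine Eq.trans ?_ (sub_eq_zero_of_eq (e1.trans e2.symm))
  simp only [criterion, Fin.sum_univ_succ, Fin.cons_zero, Fin.cons_succ, hz, map_add, h1, h2, e3,
    Pi.zero_apply, Prod.snd_add, add_zero, mul_zero, zero_mul, zero_add]
  have h0 : fderiv ℝ Q z (0, 0) = 0 := by rw [← Prod.zero_eq_mk, map_zero]
  have hq : ∀ b : Fin n, (fderiv ℝ Q z (0, if b = a then w else 0)).2 =
      if b = a then (fderiv ℝ Q z (0, w)).2 else 0 := fun b => by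
    by_cases hb : b = a <;> simp [hb, h0]
  have hq' : ∀ (b : Fin n) l, baseCLM l (fderiv ℝ Q z (0, if b = a then w else 0)) =
      if b = a then baseCLM l (fderiv ℝ Q z (0, w)) else 0 := fun b l => by
    by_cases hb : b = a <;> simp [hb, h0]
  simp only [if_true, hq, hq', h0, r, add_mul, Finset.sum_add_distrib, Finset.sum_sub_distrib,
    mul_ite, mul_zero, Finset.sum_ite_eq, Pi.single_apply, Finset.mem_univ, Fin.succ_inj, map_zero,
    Prod.snd_zero, Finset.sum_ite_eq', add_zero, Fin.succ_ne_zero, if_false,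
    zero_add, ite_mul, zero_mul]
  ring

theorem CriterionAt.space_psi_eq_zero (h : CriterionAt S Q z)
    (h1 : ∀ w, baseCLM 0 (fderiv ℝ Q z (0, w)) = 0)
    (h2 : ∀ (u : Base n × ℂ) (a : Fin n) (w : ℂ),
      baseCLM 0 (fderiv ℝ (fderiv ℝ Q) z u (Pi.single a.succ 1, w)) = 0) (a : Fin n) (w : ℂ) :
    baseCLM a.succ (fderiv ℝ Q z (0, w)) = 0 := by
  have e1 := h.diag h1 h2 a 1 1
  have e2 := h.diag h1 h2 a 0 1
  rw [clm_apply_split _ (Pi.single _ _) (1 : ℂ), map_add] at e1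
  -- Of the factor 3, one unit comes from the ψ_{aa} in D_a²ξ^a and two from the cross term
  -- 2(D_aξ^a)ψ_{aa}. As ξ^a is real, the real and imaginary parts annihilate both ψ-derivatives.
  have e3 : Complex.I * baseCLM a.succ (fderiv ℝ Q z (0, Complex.I * 1)) +
      3 * baseCLM a.succ (fderiv ℝ Q z (0, 1)) = 0 := by linear_combination e2 - e1
  simp only [baseCLM_apply, mul_one] at e3
  have hre := congrArg Complex.re e3
  have him := congrArg Complex.im e3
  simp at hre him
  have hw : ((0, w) : Base n × ℂ) = w.re • (0, 1) + w.im • (0, Complex.I) := by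
    ext <;> simp
  rw [hw, map_add, map_smul, map_smul, baseCLM_apply]
  simp [hre, him]

/-- If the real derivative of η in ψ is w ↦ αw + βw̄, then `diag` at v = 0 reads 2βw̄ + (τ_t −
2ξ^a_a)w = 0. The values w = 1 and w = i separate the two coefficients. -/
theorem CriterionAt.psi_linear (h : CriterionAt S Q z)
    (h1 : ∀ w, baseCLM 0 (fderiv ℝ Q z (0, w)) = 0)
    (h2 : ∀ (u : Base n × ℂ) (a : Fin n) (w : ℂ),
      baseCLM 0 (fderiv ℝ (fderiv ℝ Q) z u (Pi.single a.succ 1, w)) = 0) (a : Fin n) :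
    2 * baseCLM a.succ (fderiv ℝ Q z (Pi.single a.succ 1, 0)) =
        baseCLM 0 (fderiv ℝ Q z (Pi.single 0 1, 0)) ∧
      ∀ w, (fderiv ℝ Q z (0, w)).2 = w * (fderiv ℝ Q z (0, 1)).2 := by
  have e1 := h.diag h1 h2 a 0 1
  have e2 := h.diag h1 h2 a 0 Complex.I
  have e3 : ((0, Complex.I * Complex.I) : Base n × ℂ) = -(0, 1) := by simp
  rw [e3, map_neg] at e2
  simp only [Prod.snd_neg, mul_zero, sub_zero, mul_one] at e1 e2
  have hI := Complex.I_mul_I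
  rw [hI] at e2
  generalize hX : baseCLM a.succ (fderiv ℝ Q z (Pi.single a.succ 1, 0)) = X at *
  generalize baseCLM 0 (fderiv ℝ Q z (Pi.single 0 1, 0)) = T at *
  have e1' : Complex.I * (fderiv ℝ Q z (0, Complex.I)).2 + T + (fderiv ℝ Q z (0, 1)).2 -
    2 * X = 0 := by linear_combination e1 + T * hI
  refine ⟨?_, fun w => ?_⟩
  · linear_combination (-1 / 2 : ℂ) * (e1' - Complex.I * e2) + (1 / 2 : ℂ) *
      ((fderiv ℝ Q z (0, 1)).2 - T + 2 * X) * hI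
  · have e4 : (fderiv ℝ Q z (0, Complex.I)).2 = Complex.I * (fderiv ℝ Q z (0, 1)).2 := by
      linear_combination (1 / 2 : ℂ) * (e2 - Complex.I * e1') +
        (1 / 2 : ℂ) * (fderiv ℝ Q z (0, Complex.I)).2 * hI
    have hw : ((0, w) : Base n × ℂ) = w.re • (0, 1) + w.im • (0, Complex.I) := by
      ext <;> simp
    conv_lhs => rw [hw, map_add, map_smul, map_smul]
    simp only [Prod.snd_add, Prod.smul_snd, e4, Complex.real_smul]
    conv_rhs => rw [← Complex.re_add_im w]
    ring

end Pointwise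

/-- The determining equations that are of first order in the components of `Q`: `τ` depends on `t`
only, `ξ` is independent of `ψ` and conformal Killing in `x`, and `η` is holomorphic in `ψ`. -/
structure FirstOrderEqs (U : Set (Base n × ℂ)) (Q : VField n) : Prop where
  time : ∀ z ∈ U, ∀ a : Fin n, baseCLM 0 (fderiv ℝ Q z (Pi.single a.succ 1, 0)) = 0
  psi : ∀ z ∈ U, ∀ l w, baseCLM l (fderiv ℝ Q z (0, w)) = 0
  killing : ∀ z ∈ U, ∀ a b : Fin n,
    baseCLM b.succ (fderiv ℝ Q z (Pi.single a.succ 1, 0)) +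
      baseCLM a.succ (fderiv ℝ Q z (Pi.single b.succ 1, 0)) =
        if a = b then baseCLM 0 (fderiv ℝ Q z (Pi.single 0 1, 0)) else 0
  holomorphic : ∀ z ∈ U, ∀ w, (fderiv ℝ Q z (0, w)).2 = w * (fderiv ℝ Q z (0, 1)).2

section Consequences

variable {U : Set (Base n × ℂ)} {Q : VField n}

theorem baseCLM_sndDeriv_eq_zero (hU : IsOpen U) (hQ : ContDiffOn ℝ ∞ Q U) {l : Fin (n + 1)}
    {v : Base n × ℂ} (h : ∀ z ∈ U, baseCLM l (fderiv ℝ Q z v) = 0) {z : Base n × ℂ} (hz : z ∈ U)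
    (u : Base n × ℂ) : baseCLM l (fderiv ℝ (fderiv ℝ Q) z u v) = 0 :=
  clm_sndDeriv_eq_zero hU hQ ((baseCLM l).comp (ContinuousLinearMap.apply ℝ (Base n × ℂ) v))
    h hz u

theorem firstOrderEqs_of_criterion (hn : 1 ≤ n) {S : Base n × ℝ → ℂ} (hU : IsOpen U)
    (hQ : ContDiffOn ℝ ∞ Q U) (h : ∀ z ∈ U, CriterionAt S Q z) : FirstOrderEqs U Q := by
  have h1 := fun z hz => (h z hz).time_psi_eq_zero hn
  have h2 : ∀ z ∈ U, ∀ (u : Base n × ℂ) (a : Fin n) (w : ℂ),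
      baseCLM 0 (fderiv ℝ (fderiv ℝ Q) z u (Pi.single a.succ 1, w)) = 0 := fun z hz u a w =>
    baseCLM_sndDeriv_eq_zero hU hQ (fun z hz => (h z hz).time_eq_zero a w) hz u
  refine ⟨fun z hz a => (h z hz).time_eq_zero a 0, fun z hz l w => ?_, fun z hz a b => ?_,
    fun z hz => ((h z hz).psi_linear (h1 z hz) (h2 z hz) ⟨0, hn⟩).2⟩
  · refine Fin.cases (h1 z hz w) (fun a => ?_) l
    exact (h z hz).space_psi_eq_zero (h1 z hz) (h2 z hz) a w
  · split_ifs with hab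
    · subst hab
      rw [← two_mul]
      exact ((h z hz).psi_linear (h1 z hz) (h2 z hz) a).1
    · exact (h z hz).killing_offdiag hab

namespace FirstOrderEqs

variable (hU : IsOpen U) (hQ : ContDiffOn ℝ ∞ Q U) (hF : FirstOrderEqs U Q) {z : Base n × ℂ}
  (hz : z ∈ U)
include hU hQ hF hz

theorem snd_time (u : Base n × ℂ) (a : Fin n) :
    baseCLM 0 (fderiv ℝ (fderiv ℝ Q) z u (Pi.single a.succ 1, 0)) = 0 :=
  baseCLM_sndDeriv_eq_zero hU hQ (fun z hz => hF.time z hz a) hz u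

theorem snd_psi (u : Base n × ℂ) (l : Fin (n + 1)) (w : ℂ) :
    baseCLM l (fderiv ℝ (fderiv ℝ Q) z u (0, w)) = 0 :=
  baseCLM_sndDeriv_eq_zero hU hQ (fun z hz => hF.psi z hz l w) hz u

theorem snd_holomorphic (u : Base n × ℂ) (w : ℂ) :
    (fderiv ℝ (fderiv ℝ Q) z u (0, w)).2 = w * (fderiv ℝ (fderiv ℝ Q) z u (0, 1)).2 := by
  have := clm_sndDeriv_eq_zero hU hQ
    ((ContinuousLinearMap.snd ℝ (Base n) ℂ).comp (ContinuousLinearMap.apply ℝ (Base n × ℂ) (0, w)) -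
      w • ((ContinuousLinearMap.snd ℝ (Base n) ℂ).comp
        (ContinuousLinearMap.apply ℝ (Base n × ℂ) (0, 1))))
    (fun z hz => by simp [hF.holomorphic z hz w]) hz u
  simpa [sub_eq_zero] using this

theorem snd_killing (u : Base n × ℂ) (a b : Fin n) :
    baseCLM b.succ (fderiv ℝ (fderiv ℝ Q) z u (Pi.single a.succ 1, 0)) +
      baseCLM a.succ (fderiv ℝ (fderiv ℝ Q) z u (Pi.single b.succ 1, 0)) =
        if a = b then baseCLM 0 (fderiv ℝ (fderiv ℝ Q) z u (Pi.single 0 1, 0)) else 0 := by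
  have := clm_sndDeriv_eq_zero hU hQ
    ((baseCLM b.succ).comp (ContinuousLinearMap.apply ℝ (Base n × ℂ) (Pi.single a.succ 1, 0)) +
      (baseCLM a.succ).comp (ContinuousLinearMap.apply ℝ (Base n × ℂ) (Pi.single b.succ 1, 0)) -
      if a = b then
        (baseCLM 0).comp (ContinuousLinearMap.apply ℝ (Base n × ℂ) (Pi.single 0 1, 0)) else 0)
    (fun z hz => by
      have := hF.killing z hz a b
      split_ifs at this ⊢ <;> simpa [sub_eq_zero] using this) hz u
  split_ifs at this ⊢ <;> simpa [sub_eq_zero] using this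

/-- The Christoffel argument: τ_t has no x-derivative, so ξ^a_{bc} is skew in a, b while symmetric
in b, c, and cyclic permutation forces it to vanish. This excludes special conformal transformations
in every dimension. -/
theorem snd_space (a b c : Fin n) :
    baseCLM a.succ (fderiv ℝ (fderiv ℝ Q) z (Pi.single b.succ 1, 0) (Pi.single c.succ 1, 0)) = 0 := by
  have key : ∀ a b c : Fin n,
      baseCLM b.succ (fderiv ℝ (fderiv ℝ Q) z (Pi.single c.succ 1, 0) (Pi.single a.succ 1, 0)) +
      baseCLM a.succ (fderiv ℝ (fderiv ℝ Q) z (Pi.single c.succ 1, 0) (Pi.single b.succ 1, 0)) = 0 := by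
    intro a b c
    rw [snd_killing hU hQ hF hz, sndDeriv_comm hU hQ hz, snd_time hU hQ hF hz, ite_self]
  have h1 := key a b c
  have h2 := key b c a
  have h3 := key c a b
  rw [sndDeriv_comm hU hQ hz (Pi.single c.succ 1, 0) (Pi.single b.succ 1, 0)] at h1
  rw [sndDeriv_comm hU hQ hz (Pi.single a.succ 1, 0) (Pi.single c.succ 1, 0)] at h2
  rw [sndDeriv_comm hU hQ hz (Pi.single b.succ 1, 0) (Pi.single a.succ 1, 0)] at h3
  linear_combination (1 / 2 : ℂ) * (h1 - h2 + h3)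

end FirstOrderEqs

/-- The part of the criterion that is independent of the derivatives of `ψ`. -/
def zeroOrderPart (S : Base n × ℝ → ℂ) (Q : VField n) (z : Base n × ℂ) : ℂ :=
  Complex.I * (fderiv ℝ Q z (Pi.single 0 1, 0)).2 -
    S (z.1, ‖z.2‖) * z.2 * (fderiv ℝ Q z (0, 1)).2 +
    baseCLM 0 (fderiv ℝ Q z (Pi.single 0 1, 0)) * (S (z.1, ‖z.2‖) * z.2) +
    ∑ a : Fin n, (fderiv ℝ (fderiv ℝ Q) z (Pi.single a.succ 1, 0) (Pi.single a.succ 1, 0)).2 +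
    (fderiv ℝ S (z.1, ‖z.2‖) ((Q z).1, inner ℝ z.2 (Q z).2 / ‖z.2‖) * z.2 +
      S (z.1, ‖z.2‖) * (Q z).2)

/-- The symmetric ψ_{ab} are contracted with the gradient of ξ, of which only the symmetric part τ_t
δ_{ab}/2 counts. Only the trace ψ_{aa} survives, and the equation removes it together with ψ_t. -/
theorem FirstOrderEqs.criterion_eq (hU : IsOpen U) (hQ : ContDiffOn ℝ ∞ Q U)
    (hF : FirstOrderEqs U Q) {z : Base n × ℂ} (hz : z ∈ U) (S : Base n × ℝ → ℂ)
    (p : Fin (n + 1) → ℂ) (q : Fin (n + 1) → Fin (n + 1) → ℂ) (hq : ∀ μ ν, q μ ν = q ν μ)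
    (he : Complex.I * p 0 + ∑ a : Fin n, q a.succ a.succ + S (z.1, ‖z.2‖) * z.2 = 0) :
    criterion S Q z p q = zeroOrderPart S Q z + ∑ a : Fin n,
      (p a.succ * (2 * (fderiv ℝ (fderiv ℝ Q) z (Pi.single a.succ 1, 0) (0, 1)).2 -
          Complex.I * baseCLM a.succ (fderiv ℝ Q z (Pi.single 0 1, 0))) +
        p a.succ ^ 2 * (fderiv ℝ (fderiv ℝ Q) z (0, 1) (0, 1)).2) := by
  have hbase : ∀ l v w, baseCLM l (fderiv ℝ Q z (v, w)) = baseCLM l (fderiv ℝ Q z (v, 0)) := by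
    intro l v w
    rw [clm_apply_split (fderiv ℝ Q z), map_add, hF.psi z hz, add_zero]
  have hB : ∀ (a : Fin n) (w : ℂ), fderiv ℝ (fderiv ℝ Q) z (Pi.single a.succ 1, w)
      (Pi.single a.succ 1, w) =
      fderiv ℝ (fderiv ℝ Q) z (Pi.single a.succ 1, 0) (Pi.single a.succ 1, 0) +
      fderiv ℝ (fderiv ℝ Q) z (Pi.single a.succ 1, 0) (0, w) +
      fderiv ℝ (fderiv ℝ Q) z (Pi.single a.succ 1, 0) (0, w) +
      fderiv ℝ (fderiv ℝ Q) z (0, w) (0, w) := by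
    intro a w
    rw [clm_apply_split _ _ w, clm_apply_split (fderiv ℝ (fderiv ℝ Q) z) (Pi.single _ _) w]
    simp only [_root_.add_apply]
    rw [sndDeriv_comm hU hQ hz (0, w) (Pi.single a.succ 1, 0)]
    abel
  have hBbase : ∀ (a : Fin n) (w : ℂ) l, baseCLM l (fderiv ℝ (fderiv ℝ Q) z
      (Pi.single a.succ 1, w) (Pi.single a.succ 1, w)) = 0 := by
    intro a w l
    rw [hB]
    simp only [map_add, hF.snd_psi hU hQ hz, add_zero]
    exact Fin.cases (hF.snd_time hU hQ hz _ a) (fun b => hF.snd_space hU hQ hz b a a) l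
  have hBψ : ∀ (a : Fin n) (w : ℂ), (fderiv ℝ (fderiv ℝ Q) z
      (Pi.single a.succ 1, w) (Pi.single a.succ 1, w)).2 =
      (fderiv ℝ (fderiv ℝ Q) z (Pi.single a.succ 1, 0) (Pi.single a.succ 1, 0)).2 +
      2 * w * (fderiv ℝ (fderiv ℝ Q) z (Pi.single a.succ 1, 0) (0, 1)).2 +
      w ^ 2 * (fderiv ℝ (fderiv ℝ Q) z (0, 1) (0, 1)).2 := by
    intro a w
    rw [hB]
    simp only [Prod.snd_add]
    rw [hF.snd_holomorphic hU hQ hz _ w, hF.snd_holomorphic hU hQ hz (0, w) w,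
      sndDeriv_comm hU hQ hz (0, w) (0, 1), hF.snd_holomorphic hU hQ hz (0, 1) w]
    ring
  have hkill : 2 * ∑ a : Fin n, ∑ b : Fin n,
      baseCLM b.succ (fderiv ℝ Q z (Pi.single a.succ 1, 0)) * q a.succ b.succ =
      baseCLM 0 (fderiv ℝ Q z (Pi.single 0 1, 0)) * ∑ a : Fin n, q a.succ a.succ := by
    have : ∑ a : Fin n, ∑ b : Fin n,
        baseCLM b.succ (fderiv ℝ Q z (Pi.single a.succ 1, 0)) * q a.succ b.succ =
        ∑ a : Fin n, ∑ b : Fin n,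
        baseCLM a.succ (fderiv ℝ Q z (Pi.single b.succ 1, 0)) * q a.succ b.succ := by
      rw [Finset.sum_comm]
      refine Finset.sum_congr rfl fun a _ => Finset.sum_congr rfl fun b _ => ?_
      rw [hq]
    rw [two_mul]
    nth_rewrite 2 [this]
    rw [← Finset.sum_add_distrib, Finset.mul_sum]
    refine Finset.sum_congr rfl fun a _ => ?_
    rw [← Finset.sum_add_distrib]
    simp only [← add_mul, hF.killing z hz a]
    simp
  have hη : ∀ w, (fderiv ℝ Q z (Pi.single 0 1, w)).2 =
      (fderiv ℝ Q z (Pi.single 0 1, 0)).2 + w * (fderiv ℝ Q z (0, 1)).2 := by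
    intro w
    rw [clm_apply_split, Prod.snd_add, hF.holomorphic z hz]
  rw [criterion, zeroOrderPart]
  simp only [map_add, Prod.snd_add, hBbase, hF.psi z hz, hBψ _ (p _), hη (p 0), add_zero, zero_mul, zero_add,
    hF.holomorphic z hz (q _ _), hbase _ _ (p _), Fin.sum_univ_succ, hF.time z hz, mul_zero]
  simp only [Finset.sum_add_distrib, Finset.sum_sub_distrib, mul_sub, mul_assoc,
    ← Finset.mul_sum, ← Finset.sum_mul] at hkill ⊢
  have hs1 : ∑ a : Fin n, p a.succ *
      (2 * (fderiv ℝ (fderiv ℝ Q) z (Pi.single a.succ 1, 0) (0, 1)).2) =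
      2 * ∑ a : Fin n, p a.succ * (fderiv ℝ (fderiv ℝ Q) z (Pi.single a.succ 1, 0) (0, 1)).2 := by
    rw [Finset.mul_sum]
    exact Finset.sum_congr rfl fun a _ => by ring
  have hs2 : ∑ a : Fin n, p a.succ *
      (Complex.I * baseCLM a.succ (fderiv ℝ Q z (Pi.single 0 1, 0))) =
      Complex.I * ∑ a : Fin n, baseCLM a.succ (fderiv ℝ Q z (Pi.single 0 1, 0)) * p a.succ := by
    rw [Finset.mul_sum]
    exact Finset.sum_congr rfl fun a _ => by ring
  rw [hs1, hs2]
  -- The multiplier η_ψ − τ_t is the common coefficient of iψ_t and ψ_{aa} in the criterion.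
  linear_combination -hkill + ((fderiv ℝ Q z (0, 1)).2 -
    baseCLM 0 (fderiv ℝ Q z (Pi.single 0 1, 0))) * he

/-- The determining equations that come from the coefficients of the first derivatives of `ψ`. -/
structure SecondOrderEqs (U : Set (Base n × ℂ)) (Q : VField n) : Prop where
  affine : ∀ z ∈ U, (fderiv ℝ (fderiv ℝ Q) z (0, 1) (0, 1)).2 = 0
  phase : ∀ z ∈ U, ∀ a : Fin n, 2 * (fderiv ℝ (fderiv ℝ Q) z (Pi.single a.succ 1, 0) (0, 1)).2 =
    Complex.I * baseCLM a.succ (fderiv ℝ Q z (Pi.single 0 1, 0))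

/-- The ψ_a are unconstrained, so the quadratic polynomial must vanish coefficientwise; giving a
single ψ_a the values 0 and ±1 is enough. -/
theorem criterion_iff_determiningEqs (hn : 1 ≤ n) {S : Base n × ℝ → ℂ} (hU : IsOpen U)
    (hQ : ContDiffOn ℝ ∞ Q U) :
    (∀ z ∈ U, CriterionAt S Q z) ↔
      FirstOrderEqs U Q ∧ SecondOrderEqs U Q ∧ ∀ z ∈ U, zeroOrderPart S Q z = 0 := by
  constructor
  · intro h
    have hF := firstOrderEqs_of_criterion hn hU hQ h
    have key : ∀ z ∈ U, ∀ (a : Fin n) (s : ℂ), zeroOrderPart S Q z +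
      (s * (2 * (fderiv ℝ (fderiv ℝ Q) z (Pi.single a.succ 1, 0) (0, 1)).2 -
          Complex.I * baseCLM a.succ (fderiv ℝ Q z (Pi.single 0 1, 0))) +
        s ^ 2 * (fderiv ℝ (fderiv ℝ Q) z (0, 1) (0, 1)).2) = 0 := by
      intro z hz a s
      have he : Complex.I * (Fin.cons (Complex.I * (S (z.1, ‖z.2‖) * z.2)) (Pi.single a s) :
          Fin (n + 1) → ℂ) 0 + ∑ a : Fin n, (0 : Fin (n + 1) → Fin (n + 1) → ℂ) a.succ a.succ +
          S (z.1, ‖z.2‖) * z.2 = 0 := by simp [← mul_assoc]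
      have h1 := h z hz _ _ (fun _ _ => rfl) he
      rw [hF.criterion_eq hU hQ hz S _ _ (fun _ _ => rfl) he] at h1
      refine Eq.trans ?_ h1
      simp only [Fin.cons_succ]
      rw [Finset.sum_eq_single a]
      · simp
      · intro b _ hb
        simp [hb]
      · simp
    have h0 : ∀ z ∈ U, zeroOrderPart S Q z = 0 := fun z hz => by
      simpa using key z hz ⟨0, hn⟩ 0
    refine ⟨hF, ⟨fun z hz => ?_, fun z hz a => ?_⟩, h0⟩
    · have h1 := key z hz ⟨0, hn⟩ 1
      have h2 := key z hz ⟨0, hn⟩ (-1)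
      linear_combination (1 / 2 : ℂ) * (h1 + h2) - h0 z hz
    · have h1 := key z hz a 1
      have h2 := key z hz a (-1)
      linear_combination (1 / 2 : ℂ) * (h1 - h2)
  · rintro ⟨hF, hG, h0⟩ z hz p q hq he
    rw [hF.criterion_eq hU hQ hz S p q hq he, h0 z hz]
    simp [hG.affine z hz, hG.phase z hz]

end Consequences

end DeterminingEquations

/-! ### The part free of derivatives of ψ, split by the phase of ψ -/

section ZeroOrder

/-- The coefficient `η_ψ`. -/
def psiCoeff (Q : VField n) (z : Base n × ℂ) : ℂ := (fderiv ℝ Q z (0, 1)).2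

/-- The inhomogeneous part `η - η_ψ ψ`. -/
def inhomPart (Q : VField n) (z : Base n × ℂ) : ℂ := (Q z).2 - psiCoeff Q z * z.2

section Coefficients

variable {U : Set (Base n × ℂ)} (hU : IsOpen U) {Q : VField n} (hQ : ContDiffOn ℝ ∞ Q U)
include hU hQ

theorem fderiv_clm_fderiv (L : Base n × ℂ →L[ℝ] ℂ) {z : Base n × ℂ} (hz : z ∈ U)
    (u v : Base n × ℂ) :
    fderiv ℝ (fun z => L (fderiv ℝ Q z v)) z u = L (fderiv ℝ (fderiv ℝ Q) z u v) := by
  have h := (differentiableAt_fderiv hU hQ hz).hasFDerivAt.clm_apply (hasFDerivAt_const v z)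
  have h' := L.hasFDerivAt.comp z h
  rw [show (fun z => L (fderiv ℝ Q z v)) = L ∘ fun z => fderiv ℝ Q z v from rfl, h'.fderiv]
  simp

theorem contDiffOn_clm_fderiv (L : Base n × ℂ →L[ℝ] ℂ) (v : Base n × ℂ) :
    ContDiffOn ℝ ∞ (fun z => L (fderiv ℝ Q z v)) U :=
  L.contDiff.comp_contDiffOn (contDiffOn_fderiv_apply hU hQ v)

theorem contDiffOn_psiCoeff : ContDiffOn ℝ ∞ (psiCoeff Q) U :=
  contDiffOn_clm_fderiv hU hQ (ContinuousLinearMap.snd ℝ (Base n) ℂ) (0, 1)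

theorem contDiffOn_inhomPart : ContDiffOn ℝ ∞ (inhomPart Q) U :=
  hQ.snd.sub ((contDiffOn_psiCoeff hU hQ).mul contDiff_snd.contDiffOn)

theorem fderiv_psiCoeff {z : Base n × ℂ} (hz : z ∈ U) (u : Base n × ℂ) :
    fderiv ℝ (psiCoeff Q) z u = (fderiv ℝ (fderiv ℝ Q) z u (0, 1)).2 :=
  fderiv_clm_fderiv hU hQ (ContinuousLinearMap.snd ℝ (Base n) ℂ) hz u (0, 1)

theorem fderiv_inhomPart {z : Base n × ℂ} (hz : z ∈ U) (u : Base n × ℂ) :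
    fderiv ℝ (inhomPart Q) z u =
      (fderiv ℝ Q z u).2 - fderiv ℝ (psiCoeff Q) z u * z.2 - psiCoeff Q z * u.2 := by
  have h1 := (differentiableAt_of_contDiffOn hU hQ hz).hasFDerivAt.snd
  have h2 := (differentiableAt_of_contDiffOn hU (contDiffOn_psiCoeff hU hQ) hz).hasFDerivAt
  have h3 : HasFDerivAt (inhomPart Q) _ z :=
    h1.sub (h2.mul (ContinuousLinearMap.snd ℝ (Base n) ℂ).hasFDerivAt)
  rw [h3.fderiv]
  simp
  ring

variable (hF : FirstOrderEqs U Q) (hG : SecondOrderEqs U Q)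
include hF hG

theorem fderiv_psiCoeff_psi {z : Base n × ℂ} (hz : z ∈ U) (w : ℂ) :
    fderiv ℝ (psiCoeff Q) z (0, w) = 0 := by
  rw [fderiv_psiCoeff hU hQ hz, sndDeriv_comm hU hQ hz, hF.snd_holomorphic hU hQ hz,
    hG.affine z hz, mul_zero]

omit hF in
theorem fderiv_psiCoeff_space {z : Base n × ℂ} (hz : z ∈ U) (a : Fin n) :
    fderiv ℝ (psiCoeff Q) z (Pi.single a.succ 1, 0) =
      Complex.I / 2 * baseCLM a.succ (fderiv ℝ Q z (Pi.single 0 1, 0)) := by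
  rw [fderiv_psiCoeff hU hQ hz]
  linear_combination (1 / 2 : ℂ) * hG.phase z hz a

theorem fderiv_inhomPart_psi {z : Base n × ℂ} (hz : z ∈ U) (w : ℂ) :
    fderiv ℝ (inhomPart Q) z (0, w) = 0 := by
  rw [fderiv_inhomPart hU hQ hz, fderiv_psiCoeff_psi hU hQ hF hG hz, hF.holomorphic z hz, psiCoeff]
  ring

omit hF in
theorem sndDeriv_psiCoeff {z : Base n × ℂ} (hz : z ∈ U) (u : Base n × ℂ) (a : Fin n) :
    fderiv ℝ (fderiv ℝ (psiCoeff Q)) z u (Pi.single a.succ 1, 0) =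
      Complex.I / 2 * baseCLM a.succ (fderiv ℝ (fderiv ℝ Q) z u (Pi.single 0 1, 0)) := by
  rw [← fderiv_fderiv_apply hU (contDiffOn_psiCoeff hU hQ) hz]
  have hev : (fun z => fderiv ℝ (psiCoeff Q) z (Pi.single a.succ 1, 0)) =ᶠ[nhds z]
      fun z => ((Complex.I / 2) • baseCLM a.succ : Base n × ℂ →L[ℝ] ℂ)
        (fderiv ℝ Q z (Pi.single 0 1, 0)) :=
    Filter.eventuallyEq_of_mem (hU.mem_nhds hz) fun z hz => by
      simpa using fderiv_psiCoeff_space hU hQ hG hz a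
  rw [hev.fderiv_eq, fderiv_clm_fderiv hU hQ _ hz]
  simp

/-- The diagonal Killing equation differentiated in t gives 2ξ^a_{ta} = τ_{tt}. Summed over a, this
produces the term (n/4)τ_{tt} of the classifying condition. -/
theorem sndDeriv_psiCoeff_diag {z : Base n × ℂ} (hz : z ∈ U) (a : Fin n) :
    fderiv ℝ (fderiv ℝ (psiCoeff Q)) z (Pi.single a.succ 1, 0) (Pi.single a.succ 1, 0) =
      Complex.I / 4 * baseCLM 0 (fderiv ℝ (fderiv ℝ Q) z (Pi.single 0 1, 0) (Pi.single 0 1, 0)) := by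
  rw [sndDeriv_psiCoeff hU hQ hG hz, sndDeriv_comm hU hQ hz]
  have := hF.snd_killing hU hQ hz (Pi.single 0 1, 0) a a
  rw [if_pos rfl] at this
  linear_combination (Complex.I / 4) * this

omit hF hG in
theorem sndDeriv_snd {z : Base n × ℂ} (hz : z ∈ U) (v : Base n) :
    (fderiv ℝ (fderiv ℝ Q) z (v, 0) (v, 0)).2 =
      fderiv ℝ (fderiv ℝ (psiCoeff Q)) z (v, 0) (v, 0) * z.2 +
        fderiv ℝ (fderiv ℝ (inhomPart Q)) z (v, 0) (v, 0) := by
  have hH := contDiffOn_psiCoeff hU hQ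
  have hg := contDiffOn_inhomPart hU hQ
  have h1 := fderiv_clm_fderiv hU hQ (ContinuousLinearMap.snd ℝ (Base n) ℂ) hz (v, 0) (v, 0)
  have hev : (fun z => ContinuousLinearMap.snd ℝ (Base n) ℂ (fderiv ℝ Q z (v, 0))) =ᶠ[nhds z]
      fun z => fderiv ℝ (psiCoeff Q) z (v, 0) * z.2 + fderiv ℝ (inhomPart Q) z (v, 0) :=
    Filter.eventuallyEq_of_mem (hU.mem_nhds hz) fun z hz => by
      simp [fderiv_inhomPart hU hQ hz]
  have h2 := ((differentiableAt_of_contDiffOn hU (contDiffOn_fderiv_apply hU hH (v, 0))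
    hz).hasFDerivAt.mul (ContinuousLinearMap.snd ℝ (Base n) ℂ).hasFDerivAt).add
    (differentiableAt_of_contDiffOn hU (contDiffOn_fderiv_apply hU hg (v, 0)) hz).hasFDerivAt
  have h3 := (h2.congr_of_eventuallyEq hev).fderiv
  rw [h3] at h1
  simp only [_root_.add_apply, _root_.smul_apply, ContinuousLinearMap.coe_snd',
    smul_eq_mul, mul_zero, zero_add, fderiv_fderiv_apply hU hH hz,
    fderiv_fderiv_apply hU hg hz] at h1
  rw [← h1]
  ring

end Coefficients

/-- The coefficient of `ψ` in the zero-order part. -/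
def zeroOrderLinear (S : Base n × ℝ → ℂ) (Q : VField n) (z : Base n × ℂ) : ℂ :=
  Complex.I * fderiv ℝ (psiCoeff Q) z (Pi.single 0 1, 0) +
    baseCLM 0 (fderiv ℝ Q z (Pi.single 0 1, 0)) * S (z.1, ‖z.2‖) +
    n * (Complex.I / 4) *
      baseCLM 0 (fderiv ℝ (fderiv ℝ Q) z (Pi.single 0 1, 0) (Pi.single 0 1, 0)) +
    fderiv ℝ S (z.1, ‖z.2‖) ((Q z).1, 0) + ‖z.2‖ * (psiCoeff Q z).re * dRho S (z.1, ‖z.2‖)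

/-- The expression of the equation linear in the inhomogeneous part. -/
def zeroOrderConst (S : Base n × ℝ → ℂ) (Q : VField n) (z : Base n × ℂ) : ℂ :=
  Complex.I * fderiv ℝ (inhomPart Q) z (Pi.single 0 1, 0) +
    ∑ a : Fin n, fderiv ℝ (fderiv ℝ (inhomPart Q)) z (Pi.single a.succ 1, 0)
      (Pi.single a.succ 1, 0) + S (z.1, ‖z.2‖) * inhomPart Q z

/-- After inserting η = η_ψ ψ + η⁰, the terms ±Sη_ψψ cancel, and |ψ| changes along η_ψ ψ at the rate
|ψ| Re η_ψ. -/
theorem zeroOrderPart_eq {U : Set (Base n × ℂ)} (hU : IsOpen U) {Q : VField n}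
    (hQ : ContDiffOn ℝ ∞ Q U) (hF : FirstOrderEqs U Q) (hG : SecondOrderEqs U Q)
    (S : Base n × ℝ → ℂ) {z : Base n × ℂ} (hz : z ∈ U) (hψ : z.2 ≠ 0) :
    zeroOrderPart S Q z = zeroOrderLinear S Q z * z.2 + zeroOrderConst S Q z +
      dRho S (z.1, ‖z.2‖) * (inner ℝ z.2 (inhomPart Q z) / ‖z.2‖ : ℝ) * z.2 := by
  have hρ : ‖z.2‖ ≠ 0 := norm_ne_zero_iff.2 hψ
  have hη : (Q z).2 = psiCoeff Q z * z.2 + inhomPart Q z := by simp [inhomPart]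
  have hinner : inner ℝ z.2 (Q z).2 / ‖z.2‖ =
      ‖z.2‖ * (psiCoeff Q z).re + inner ℝ z.2 (inhomPart Q z) / ‖z.2‖ := by
    have : inner ℝ z.2 (psiCoeff Q z * z.2) = ‖z.2‖ ^ 2 * (psiCoeff Q z).re := by
      rw [← Complex.normSq_eq_norm_sq, Complex.normSq_apply, Complex.inner]
      simp
      ring
    rw [hη, inner_add_right, this]
    field_simp
  have hS : fderiv ℝ S (z.1, ‖z.2‖) ((Q z).1, inner ℝ z.2 (Q z).2 / ‖z.2‖) =
      fderiv ℝ S (z.1, ‖z.2‖) ((Q z).1, 0) +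
        (inner ℝ z.2 (Q z).2 / ‖z.2‖ : ℝ) * dRho S (z.1, ‖z.2‖) := by
    rw [dRho, ← Complex.real_smul, ← map_smul, ← map_add]
    simp
  have ht : (fderiv ℝ Q z (Pi.single 0 1, 0)).2 =
      fderiv ℝ (psiCoeff Q) z (Pi.single 0 1, 0) * z.2 +
        fderiv ℝ (inhomPart Q) z (Pi.single 0 1, 0) := by
    rw [fderiv_inhomPart hU hQ hz]
    simp
  rw [zeroOrderPart, hS, hinner, ht]
  simp only [sndDeriv_snd hU hQ hz, sndDeriv_psiCoeff_diag hU hQ hF hG hz, Finset.sum_add_distrib,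
    Finset.sum_const, Finset.card_univ, Fintype.card_fin, nsmul_eq_mul]
  rw [show (fderiv ℝ Q z (0, 1)).2 = psiCoeff Q z from rfl, hη, zeroOrderLinear, zeroOrderConst]
  push_cast
  ring

section Rotation

variable {D : Set (Base n × ℝ)} (hD : IsAdmissibleDomain D) {Q : VField n}
  (hQ : ContDiffOn ℝ ∞ Q (pointSpace D)) (hF : FirstOrderEqs (pointSpace D) Q)
  (hG : SecondOrderEqs (pointSpace D) Q)
include hD hQ hF hG

theorem zeroOrderLinear_rotation (S : Base n × ℝ → ℂ) {z : Base n × ℂ} (hz : z ∈ pointSpace D)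
    {c : ℂ} (hc : ‖c‖ = 1) :
    zeroOrderLinear S Q (z.1, c * z.2) = zeroOrderLinear S Q z := by
  have hU := hD.isOpen_pointSpace
  have hz' : ((z.1, c * z.2) : Base n × ℂ) ∈ pointSpace D := by
    simpa [pointSpace, hc] using hz
  have hH := contDiffOn_psiCoeff hU hQ
  have hHψ := fun z hz => fderiv_psiCoeff_psi hU hQ hF hG (z := z) hz
  have hT := contDiffOn_clm_fderiv hU hQ (baseCLM 0) (Pi.single 0 1, 0)
  have hTψ : ∀ z ∈ pointSpace D, ∀ w : ℂ,
      fderiv ℝ (fun z => baseCLM 0 (fderiv ℝ Q z (Pi.single 0 1, 0))) z (0, w) = 0 := by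
    intro z hz w
    rw [fderiv_clm_fderiv hU hQ _ hz, sndDeriv_comm hU hQ hz, hF.snd_psi hU hQ hz]
  have e1 := fderiv_rotation_invariant hD hH hHψ hz hc (Pi.single 0 1)
  have e2 := hD.rotation_invariant hT hTψ hz hc
  have e3 := fderiv_rotation_invariant hD hT hTψ hz hc (Pi.single 0 1)
  have e4 := hD.rotation_invariant hH hHψ hz hc
  have e5 := hD.rotation_invariant hQ.fst (fun z hz w => by
    rw [(differentiableAt_of_contDiffOn hU hQ hz).hasFDerivAt.fst.fderiv]
    ext l
    simpa [baseCLM_apply] using hF.psi z hz l w) hz hc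
  rw [fderiv_clm_fderiv hU hQ _ hz, fderiv_clm_fderiv hU hQ _ hz'] at e3
  simp only [zeroOrderLinear, e1, e2, e3, e4, e5, norm_mul, hc, one_mul]

theorem inhomPart_rotation {z : Base n × ℂ} (hz : z ∈ pointSpace D)
    {c : ℂ} (hc : ‖c‖ = 1) : inhomPart Q (z.1, c * z.2) = inhomPart Q z :=
  hD.rotation_invariant (contDiffOn_inhomPart hD.isOpen_pointSpace hQ)
    (fun _ hz => fderiv_inhomPart_psi hD.isOpen_pointSpace hQ hF hG hz) hz hc

theorem zeroOrderConst_rotation (S : Base n × ℝ → ℂ) {z : Base n × ℂ} (hz : z ∈ pointSpace D)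
    {c : ℂ} (hc : ‖c‖ = 1) :
    zeroOrderConst S Q (z.1, c * z.2) = zeroOrderConst S Q z := by
  have hU := hD.isOpen_pointSpace
  have hz' : ((z.1, c * z.2) : Base n × ℂ) ∈ pointSpace D := by
    simpa [pointSpace, hc] using hz
  have hg := contDiffOn_inhomPart hU hQ
  have hgψ := fun z hz => fderiv_inhomPart_psi hU hQ hF hG (z := z) hz
  have e1 := fderiv_rotation_invariant hD hg hgψ hz hc (Pi.single 0 1)
  have e2 : ∀ v : Base n, fderiv ℝ (fderiv ℝ (inhomPart Q)) (z.1, c * z.2) (v, 0) (v, 0) =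
      fderiv ℝ (fderiv ℝ (inhomPart Q)) z (v, 0) (v, 0) := by
    intro v
    have := fderiv_rotation_invariant hD (contDiffOn_fderiv_apply hU hg (v, 0))
      (fun z hz w => by
        rw [fderiv_fderiv_apply hU hg hz, sndDeriv_comm hU hg hz]
        exact clm_sndDeriv_eq_zero hU hg
          (ContinuousLinearMap.apply ℝ ℂ ((0, w) : Base n × ℂ)) (fun z hz => hgψ z hz w) hz _)
      hz hc v
    rwa [fderiv_fderiv_apply hU hg hz, fderiv_fderiv_apply hU hg hz'] at this
  simp only [zeroOrderConst, e1, e2, inhomPart_rotation hD hQ hF hG hz hc, norm_mul, hc, one_mul]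

/-- Splitting the zero-order equation with respect to the phase of `ψ`. -/
theorem zeroOrder_split {S : Base n × ℝ → ℂ} (h0 : ∀ z ∈ pointSpace D, zeroOrderPart S Q z = 0)
    {z : Base n × ℂ} (hz : z ∈ pointSpace D) :
    zeroOrderLinear S Q z = 0 ∧ (dRho S (z.1, ‖z.2‖) ≠ 0 → inhomPart Q z = 0) := by
  have hU := hD.isOpen_pointSpace
  have hψ := hD.ne_zero hz
  have hρ : (‖z.2‖ : ℂ) ≠ 0 := by simpa using hψ
  have key : ∀ c : ℂ, ‖c‖ = 1 → zeroOrderLinear S Q z * (c * z.2) + zeroOrderConst S Q z +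
      dRho S (z.1, ‖z.2‖) * (inner ℝ (c * z.2) (inhomPart Q z) / ‖z.2‖ : ℝ) * (c * z.2) = 0 := by
    intro c hc
    have hz' : ((z.1, c * z.2) : Base n × ℂ) ∈ pointSpace D := by
      simpa [pointSpace, hc] using hz
    have h1 := h0 _ hz'
    rw [zeroOrderPart_eq hU hQ hF hG S hz' (hD.ne_zero hz'), zeroOrderLinear_rotation hD hQ hF hG S
      hz hc, zeroOrderConst_rotation hD hQ hF hG S hz hc, inhomPart_rotation hD hQ hF hG hz hc] at h1
    simpa only [norm_mul, hc, one_mul] using h1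
  -- As functions of the phase c, the three summands carry the Fourier modes {1}, {0} and {0, 2}.
  -- Comparing c = ±1 isolates mode 1; then comparing c = 1 with c = i isolates mode 2, whose
  -- vanishing kills the real and imaginary parts of ψ̄η⁰.
  have k1 := key 1 (by simp)
  have k2 := key (-1) (by simp)
  have k3 := key Complex.I (by simp)
  have hm : inner ℝ (-1 * z.2) (inhomPart Q z) = -inner ℝ z.2 (inhomPart Q z) := by
    simp
  rw [hm] at k2
  rw [one_mul] at k1
  push_cast at k1 k2 k3
  have hL : zeroOrderLinear S Q z = 0 := by
    have : zeroOrderLinear S Q z * z.2 = 0 := by linear_combination (1 / 2 : ℂ) * (k1 - k2)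
    exact (mul_eq_zero.1 this).resolve_right hψ
  refine ⟨hL, fun hS => ?_⟩
  rw [hL] at k1 k3
  have k4 : dRho S (z.1, ‖z.2‖) * z.2 / ‖z.2‖ * ((inner ℝ z.2 (inhomPart Q z) : ℝ) -
      Complex.I * (inner ℝ (Complex.I * z.2) (inhomPart Q z) : ℝ)) = 0 := by
    linear_combination k1 - k3
  have k5 := (mul_eq_zero.1 k4).resolve_left (by simp [hS, hψ, hρ])
  have hre := congrArg Complex.re k5
  have him := congrArg Complex.im k5
  simp only [Complex.inner] at hre him
  simp at hre him
  have : (starRingEnd ℂ) z.2 * inhomPart Q z = 0 := by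
    apply Complex.ext <;> simp <;> linarith
  exact (mul_eq_zero.1 this).resolve_left (by simpa using hψ)

theorem inhomPart_eq_zero {S : Base n × ℝ → ℂ} (hS : IsClassS D S)
    (h0 : ∀ z ∈ pointSpace D, zeroOrderPart S Q z = 0) {z : Base n × ℂ}
    (hz : z ∈ pointSpace D) : inhomPart Q z = 0 := by
  have hU := hD.isOpen_pointSpace
  have hcont : ContinuousAt (inhomPart Q) z :=
    (differentiableAt_of_contDiffOn hU (contDiffOn_inhomPart hU hQ) hz).continuousAt
  -- Lifts points of D to (t, x, ψ) keeping the phase of `z`, so that the density of {S_ρ ≠ 0} in D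
  -- can be used near `z`.
  let g : Base n × ℝ → Base n × ℂ := fun p => (p.1, (p.2 / ‖z.2‖ : ℝ) * z.2)
  have hψ := hD.ne_zero hz
  have hg : g (z.1, ‖z.2‖) = z := by
    simp only [g, div_self (norm_ne_zero_iff.2 hψ), Complex.ofReal_one, one_mul]
  have hgc : ContinuousAt g (z.1, ‖z.2‖) := by
    have : Continuous g := by simp only [g]; fun_prop
    exact this.continuousAt
  have hmem := hS.dRho_ne_zero hz
  rw [mem_closure_iff_frequently] at hmem
  by_contra hne
  have hcont' : ContinuousAt (fun p => inhomPart Q (g p)) (z.1, ‖z.2‖) :=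
    ContinuousAt.comp (g := inhomPart Q) (by rwa [hg]) hgc
  have hev := hcont'.eventually_ne (y := 0) (by rwa [hg])
  obtain ⟨p, ⟨hpD, hp⟩, hp'⟩ := (hmem.and_eventually hev).exists
  have hpn : ‖(g p).2‖ = p.2 := by
    have := hD.rho_pos p hpD
    simp [g, abs_of_pos this, norm_ne_zero_iff.2 hψ]
  have hgp : g p ∈ pointSpace D := by
    show ((g p).1, ‖(g p).2‖) ∈ D
    rw [hpn]; exact hpD
  refine hp' ((zeroOrder_split hD hQ hF hG h0 hgp).2 ?_)
  rw [hpn]; exact hp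

end Rotation

end ZeroOrder

/-! ### The general field in components and its derivatives -/

section NormalForm

/-- The component `ξ^a` of the general field. -/
def spaceComp (τ : ℝ → ℝ) (κ : Matrix (Fin n) (Fin n) ℝ) (χ : Fin n → ℝ → ℝ) (a : Fin n)
    (z : Base n × ℂ) : ℝ :=
  1 / 2 * deriv τ (z.1 0) * z.1 a.succ + ∑ b : Fin n, κ a b * z.1 b.succ + χ a (z.1 0)

/-- The coefficient of `M` in the general field. -/
def phaseComp (τ : ℝ → ℝ) (χ : Fin n → ℝ → ℝ) (σ : ℝ → ℝ) (z : Base n × ℂ) : ℝ :=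
  1 / 8 * iteratedDeriv 2 τ (z.1 0) * ∑ a : Fin n, z.1 a.succ * z.1 a.succ +
    1 / 2 * ∑ a : Fin n, deriv (χ a) (z.1 0) * z.1 a.succ + σ (z.1 0)

/-- The component along x_c collects κ_{cb}x_b from b > c and −κ_{ac}x_a from a < c; skew-symmetry
merges them into one full sum with zero diagonal term. -/
theorem sum_fieldJ (κ : Matrix (Fin n) (Fin n) ℝ) (hκ : κ.transpose = -κ) (z : Base n × ℂ) :
    -∑ a : Fin n, ∑ b ∈ Finset.Ioi a, κ a b • fieldJ a b z =
      (Fin.cons 0 fun a => ∑ b : Fin n, κ a b * z.1 b.succ, 0) := by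
  have hk : ∀ a b, κ b a = -κ a b := fun a b => congrFun (congrFun hκ a) b
  refine Prod.ext (funext fun l => ?_) ?_
  · refine Fin.cases ?_ (fun c => ?_) l
    · simp [Prod.fst_sum, fieldJ, Finset.sum_apply]
    · have h1 : (∑ a : Fin n, ∑ b ∈ Finset.Ioi a, κ a b • fieldJ a b z).1 c.succ =
          ∑ a : Fin n, ∑ b : Fin n, if a < b then κ a b *
            ((if c = b then z.1 a.succ else 0) - (if c = a then z.1 b.succ else 0)) else 0 := by
        simp only [Prod.fst_sum, Finset.sum_apply, fieldJ]
        refine Finset.sum_congr rfl fun a _ => ?_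
        rw [← Finset.sum_filter]
        refine Finset.sum_congr (by ext; simp) fun b _ => ?_
        simp [Pi.single_apply]
      have h2 : (∑ a : Fin n, ∑ b : Fin n, if a < b then κ a b *
            ((if c = b then z.1 a.succ else 0) - (if c = a then z.1 b.succ else 0)) else 0) =
          (∑ a : Fin n, if a < c then κ a c * z.1 a.succ else 0) -
            ∑ b : Fin n, if c < b then κ c b * z.1 b.succ else 0 := by
        have : ∀ a b : Fin n, (if a < b then κ a b *
            ((if c = b then z.1 a.succ else 0) - (if c = a then z.1 b.succ else 0)) else 0) =
            (if c = b then if a < c then κ a c * z.1 a.succ else 0 else 0) -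
            (if c = a then if c < b then κ c b * z.1 b.succ else 0 else 0) := by
          intro a b
          rcases eq_or_ne c b with rfl | h1 <;> rcases eq_or_ne c a with rfl | h2
          · simp
          · simp [h2]
          · by_cases h3 : c < b <;> simp [h1, h3]
          · simp [h1, h2]
        simp only [this, Finset.sum_sub_distrib, Finset.sum_ite_eq, Finset.mem_univ, if_true]
        congr 1
        rw [Finset.sum_comm]
        simp
      change _ = ∑ b : Fin n, κ c b * z.1 b.succ
      rw [Prod.fst_neg, Pi.neg_apply, h1, h2, neg_sub, ← Finset.sum_sub_distrib]
      refine Finset.sum_congr rfl fun b _ => ?_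
      rcases lt_trichotomy b c with h | h | h
      · simp [h, h.not_gt, hk c b]
      · subst h
        have := hk b b
        simp [show κ b b = 0 by linarith]
      · simp [h, h.not_gt]
  · simp [Prod.snd_sum, fieldJ]

theorem generalField_eq (τ : ℝ → ℝ) {κ : Matrix (Fin n) (Fin n) ℝ} (hκ : κ.transpose = -κ)
    (χ : Fin n → ℝ → ℝ) (σ ζ : ℝ → ℝ) (z : Base n × ℂ) :
    generalField τ κ χ σ ζ z = (Fin.cons (τ (z.1 0)) fun a => spaceComp τ κ χ a z,
      (phaseComp τ χ σ z * Complex.I + ζ (z.1 0)) * z.2) := by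
  rw [generalField, sub_eq_add_neg, sum_fieldJ κ hκ]
  refine Prod.ext (funext fun l => ?_) ?_
  · refine Fin.cases ?_ (fun c => ?_) l
    · simp [fieldD, fieldP, fieldM, fieldI]
    · simp [fieldD, fieldP, fieldM, fieldI, spaceComp]
  · simp only [fieldD, fieldP, fieldM, fieldI, phaseComp, Prod.snd_add, Prod.smul_snd,
      Complex.real_smul]
    push_cast
    ring

section Derivatives

variable {T : Set ℝ} (hT : IsOpen T) {τ : ℝ → ℝ} {χ : Fin n → ℝ → ℝ} {σ ζ : ℝ → ℝ}

theorem contDiffOn_deriv_infty {F : Type*} [NormedAddCommGroup F] [NormedSpace ℝ F] {φ : ℝ → F}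
    (hT : IsOpen T) (hφ : ContDiffOn ℝ ∞ φ T) : ContDiffOn ℝ ∞ (deriv φ) T :=
  hφ.deriv_of_isOpen hT (by simp)

theorem iteratedDeriv_two_eq (φ : ℝ → ℝ) : iteratedDeriv 2 φ = deriv (deriv φ) := by
  rw [iteratedDeriv_succ, iteratedDeriv_one]

theorem contDiffOn_iteratedDeriv_two {φ : ℝ → ℝ}
    (hT : IsOpen T) (hφ : ContDiffOn ℝ ∞ φ T) : ContDiffOn ℝ ∞ (iteratedDeriv 2 φ) T := by
  rw [iteratedDeriv_two_eq]
  exact contDiffOn_deriv_infty hT (contDiffOn_deriv_infty hT hφ)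

theorem contDiffOn_comp_time {F : Type*} [NormedAddCommGroup F] [NormedSpace ℝ F] {φ : ℝ → F}
    (hφ : ContDiffOn ℝ ∞ φ T) {U : Set (Base n × ℂ)} (hUT : ∀ z ∈ U, z.1 0 ∈ T) :
    ContDiffOn ℝ ∞ (fun z : Base n × ℂ => φ (z.1 0)) U :=
  hφ.comp (timeCLM n).contDiff.contDiffOn hUT

theorem hasDerivAt_comp_time {F : Type*} [NormedAddCommGroup F] [NormedSpace ℝ F] {φ : ℝ → F}
    (hT : IsOpen T) (hφ : ContDiffOn ℝ ∞ φ T) {z : Base n × ℂ} (hz : z.1 0 ∈ T)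
    (v : Base n × ℂ) :
    HasDerivAt (fun s : ℝ => φ ((z + s • v).1 0)) (v.1 0 • deriv φ (z.1 0)) 0 := by
  have h1 : HasDerivAt (fun s : ℝ => (z + s • v).1 0) (v.1 0) 0 := by
    simpa using ((hasDerivAt_id (0 : ℝ)).mul_const (v.1 0)).const_add (z.1 0)
  have h2 : HasDerivAt φ (deriv φ (z.1 0)) ((z + (0 : ℝ) • v).1 0) := by
    simpa using (differentiableAt_of_contDiffOn hT hφ hz).hasDerivAt
  exact HasDerivAt.scomp (h := fun s : ℝ => (z + s • v).1 0) 0 h2 h1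

theorem hasDerivAt_coord (z v : Base n × ℂ) (l : Fin (n + 1)) :
    HasDerivAt (fun s : ℝ => (z + s • v).1 l) (v.1 l) 0 := by
  simpa using ((hasDerivAt_id (0 : ℝ)).mul_const (v.1 l)).const_add (z.1 l)

theorem contDiff_coord (l : Fin (n + 1)) : ContDiff ℝ ∞ (fun z : Base n × ℂ => z.1 l) :=
  ((ContinuousLinearMap.proj (R := ℝ) (φ := fun _ : Fin (n + 1) => ℝ) l).comp
    (ContinuousLinearMap.fst ℝ (Base n) ℂ)).contDiff

variable {U : Set (Base n × ℂ)} (hU : IsOpen U) (hUT : ∀ z ∈ U, z.1 0 ∈ T)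

include hT hUT in
theorem contDiffOn_spaceComp (hτ : ContDiffOn ℝ ∞ τ T) (κ : Matrix (Fin n) (Fin n) ℝ)
    (hχ : ∀ a, ContDiffOn ℝ ∞ (χ a) T) (a : Fin n) : ContDiffOn ℝ ∞ (spaceComp τ κ χ a) U := by
  refine ContDiffOn.add (ContDiffOn.add (ContDiffOn.mul (contDiffOn_const.mul
    (contDiffOn_comp_time (contDiffOn_deriv_infty hT hτ) hUT)) (contDiff_coord _).contDiffOn) ?_)
    (contDiffOn_comp_time (hχ a) hUT)
  exact ContDiffOn.sum fun b _ => contDiffOn_const.mul (contDiff_coord _).contDiffOn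

include hT hUT in
theorem contDiffOn_phaseComp (hτ : ContDiffOn ℝ ∞ τ T)
    (hχ : ∀ a, ContDiffOn ℝ ∞ (χ a) T) (hσ : ContDiffOn ℝ ∞ σ T) :
    ContDiffOn ℝ ∞ (phaseComp τ χ σ) U := by
  refine ContDiffOn.add (ContDiffOn.add (ContDiffOn.mul (contDiffOn_const.mul
    (contDiffOn_comp_time (contDiffOn_iteratedDeriv_two hT hτ) hUT)) ?_) ?_)
    (contDiffOn_comp_time hσ hUT)
  · exact ContDiffOn.sum fun b _ => (contDiff_coord _).contDiffOn.mul (contDiff_coord _).contDiffOn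
  · exact contDiffOn_const.mul (ContDiffOn.sum fun b _ =>
      (contDiffOn_comp_time (contDiffOn_deriv_infty hT (hχ b)) hUT).mul
        (contDiff_coord _).contDiffOn)

include hT hU hUT

theorem fderiv_comp_time {F : Type*} [NormedAddCommGroup F] [NormedSpace ℝ F] {φ : ℝ → F}
    (hφ : ContDiffOn ℝ ∞ φ T) {z : Base n × ℂ} (hz : z ∈ U) (v : Base n × ℂ) :
    fderiv ℝ (fun z : Base n × ℂ => φ (z.1 0)) z v = v.1 0 • deriv φ (z.1 0) :=
  fderiv_apply_eq_of_hasDerivAt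
    (differentiableAt_of_contDiffOn hU (contDiffOn_comp_time hφ hUT) hz)
    (hasDerivAt_comp_time hT hφ (hUT z hz) v)

theorem fderiv_spaceComp (hτ : ContDiffOn ℝ ∞ τ T) (κ : Matrix (Fin n) (Fin n) ℝ)
    (hχ : ∀ a, ContDiffOn ℝ ∞ (χ a) T) (a : Fin n) {z : Base n × ℂ} (hz : z ∈ U)
    (v : Base n × ℂ) :
    fderiv ℝ (spaceComp τ κ χ a) z v =
      1 / 2 * iteratedDeriv 2 τ (z.1 0) * v.1 0 * z.1 a.succ +
        1 / 2 * deriv τ (z.1 0) * v.1 a.succ + ∑ b : Fin n, κ a b * v.1 b.succ +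
        deriv (χ a) (z.1 0) * v.1 0 := by
  refine fderiv_apply_eq_of_hasDerivAt
    (differentiableAt_of_contDiffOn hU (contDiffOn_spaceComp hT hUT hτ κ hχ a) hz) ?_
  have h := ((((hasDerivAt_comp_time hT (contDiffOn_deriv_infty hT hτ) (hUT z hz) v).const_mul
    (1 / 2 : ℝ)).mul (hasDerivAt_coord z v a.succ)).add (HasDerivAt.fun_sum (u := Finset.univ)
      fun b _ => (hasDerivAt_coord z v b.succ).const_mul (κ a b))).add
    (hasDerivAt_comp_time hT (hχ a) (hUT z hz) v)
  refine h.congr_deriv ?_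
  simp only [zero_smul, add_zero, smul_eq_mul, iteratedDeriv_two_eq]
  ring

/-- The coefficient of each spatial direction is half of ξ^a_t, in agreement with 2η_{ψa} = iξ^a_t;
this fixes the factors 1/8 and 1/2 in the phase. -/
theorem fderiv_phaseComp (hτ : ContDiffOn ℝ ∞ τ T)
    (hχ : ∀ a, ContDiffOn ℝ ∞ (χ a) T) (hσ : ContDiffOn ℝ ∞ σ T) {z : Base n × ℂ} (hz : z ∈ U)
    (v : Base n × ℂ) :
    fderiv ℝ (phaseComp τ χ σ) z v =
      (1 / 8 * iteratedDeriv 3 τ (z.1 0) * ∑ a : Fin n, z.1 a.succ * z.1 a.succ +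
        1 / 2 * ∑ a : Fin n, iteratedDeriv 2 (χ a) (z.1 0) * z.1 a.succ + deriv σ (z.1 0)) * v.1 0 +
      ∑ a : Fin n, (1 / 4 * iteratedDeriv 2 τ (z.1 0) * z.1 a.succ +
        1 / 2 * deriv (χ a) (z.1 0)) * v.1 a.succ := by
  refine fderiv_apply_eq_of_hasDerivAt
    (differentiableAt_of_contDiffOn hU (contDiffOn_phaseComp hT hUT hτ hχ hσ) hz) ?_
  have h := ((((hasDerivAt_comp_time hT (contDiffOn_iteratedDeriv_two hT hτ) (hUT z hz) v).const_mul
    (1 / 8 : ℝ)).mul (HasDerivAt.fun_sum (u := Finset.univ)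
      fun b _ => (hasDerivAt_coord z v (Fin.succ b)).mul (hasDerivAt_coord z v (Fin.succ b)))).add
    ((HasDerivAt.fun_sum (u := Finset.univ) fun a _ =>
      (hasDerivAt_comp_time hT (contDiffOn_deriv_infty hT (hχ a)) (hUT z hz) v).mul
        (hasDerivAt_coord z v (Fin.succ a))).const_mul (1 / 2 : ℝ))).add
    (hasDerivAt_comp_time hT hσ (hUT z hz) v)
  refine h.congr_deriv ?_
  simp only [zero_smul, add_zero, smul_eq_mul, iteratedDeriv_succ (n := 2), iteratedDeriv_two_eq]
  simp only [Pi.mul_apply, zero_smul, add_zero, add_mul, mul_add, Finset.sum_add_distrib,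
    Finset.mul_sum, Finset.sum_mul]
  ring_nf
  simp only [← Finset.sum_add_distrib, add_assoc]
  refine congrArg₂ _ rfl (Finset.sum_congr rfl fun a _ => ?_)
  ring

end Derivatives

end NormalForm

/-! ### Determining equations versus normal form -/

section Classification

theorem fderiv_base_comp {Q : VField n} {z : Base n × ℂ} (hQ : DifferentiableAt ℝ Q z)
    (v : Base n × ℂ) (l : Fin (n + 1)) :
    (fderiv ℝ Q z v).1 l = fderiv ℝ (fun z => (Q z).1 l) z v := by
  have h := ((ContinuousLinearMap.proj (R := ℝ) (φ := fun _ : Fin (n + 1) => ℝ) l).comp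
    (ContinuousLinearMap.fst ℝ (Base n) ℂ)).hasFDerivAt.comp z hQ.hasFDerivAt
  exact (congrArg (fun T => T v) h.fderiv).symm

theorem fderiv_psi_comp {Q : VField n} {z : Base n × ℂ} (hQ : DifferentiableAt ℝ Q z)
    (v : Base n × ℂ) : (fderiv ℝ Q z v).2 = fderiv ℝ (fun z => (Q z).2) z v := by
  rw [hQ.hasFDerivAt.snd.fderiv]
  rfl

/-- The vector field `Q` has the form of the general field on `U`, written by components. -/
def HasNormalForm (U : Set (Base n × ℂ)) (Q : VField n) (τ : ℝ → ℝ)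
    (κ : Matrix (Fin n) (Fin n) ℝ) (χ : Fin n → ℝ → ℝ) (σ ζ : ℝ → ℝ) : Prop :=
  ∀ z ∈ U, Q z = (Fin.cons (τ (z.1 0)) fun a => spaceComp τ κ χ a z,
    (phaseComp τ χ σ z * Complex.I + ζ (z.1 0)) * z.2)

section FromNormalForm

variable {T : Set ℝ} (hT : IsOpen T) {τ : ℝ → ℝ} {χ : Fin n → ℝ → ℝ} {σ ζ : ℝ → ℝ}
  {κ : Matrix (Fin n) (Fin n) ℝ}
  {U : Set (Base n × ℂ)} (hU : IsOpen U) (hUT : ∀ z ∈ U, z.1 0 ∈ T)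
  (hτ : ContDiffOn ℝ ∞ τ T) (hχ : ∀ a, ContDiffOn ℝ ∞ (χ a) T) (hσ : ContDiffOn ℝ ∞ σ T)
  (hζ : ContDiffOn ℝ ∞ ζ T) {Q : VField n} (hN : HasNormalForm U Q τ κ χ σ ζ)

include hT hUT hτ hχ hσ hζ in
theorem contDiffOn_psiFactor :
    ContDiffOn ℝ ∞ (fun z => (phaseComp τ χ σ z * Complex.I + ζ (z.1 0) : ℂ)) U :=
  ((Complex.ofRealCLM.contDiff.comp_contDiffOn
    (contDiffOn_phaseComp hT hUT hτ hχ hσ)).mul contDiffOn_const).add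
    (Complex.ofRealCLM.contDiff.comp_contDiffOn (contDiffOn_comp_time hζ hUT))

include hT hU hUT hτ hχ hσ hζ in
theorem fderiv_psiFactor {z : Base n × ℂ} (hz : z ∈ U) (v : Base n × ℂ) :
    fderiv ℝ (fun z => (phaseComp τ χ σ z * Complex.I + ζ (z.1 0) : ℂ)) z v =
      (fderiv ℝ (phaseComp τ χ σ) z v : ℝ) * Complex.I + (v.1 0 * deriv ζ (z.1 0) : ℝ) := by
  have h1 := Complex.ofRealCLM.hasFDerivAt.comp z (differentiableAt_of_contDiffOn hU
    (contDiffOn_phaseComp hT hUT hτ hχ hσ) hz).hasFDerivAt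
  have h2 := Complex.ofRealCLM.hasFDerivAt.comp z (differentiableAt_of_contDiffOn hU
    (contDiffOn_comp_time hζ hUT) hz).hasFDerivAt
  have h3 := ((h1.mul_const Complex.I).add h2).fderiv
  refine (congrArg (fun L => L v) h3).trans ?_
  simp [fderiv_comp_time hT hU hUT hζ hz, mul_comm]

include hT hUT hτ hχ hσ hζ hN in
theorem HasNormalForm.contDiffOn : ContDiffOn ℝ ∞ Q U := by
  refine ContDiffOn.congr (ContDiffOn.prodMk (contDiffOn_pi.2 fun l => ?_)
    ((contDiffOn_psiFactor hT hUT hτ hχ hσ hζ).mul contDiff_snd.contDiffOn)) hN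
  refine Fin.cases ?_ (fun a => ?_) l
  · exact contDiffOn_comp_time hτ hUT
  · exact contDiffOn_spaceComp hT hUT hτ κ hχ a

include hT hU hUT hτ hχ hσ hζ hN

theorem HasNormalForm.fderiv_time {z : Base n × ℂ} (hz : z ∈ U) (v : Base n × ℂ) :
    baseCLM 0 (fderiv ℝ Q z v) = (v.1 0 * deriv τ (z.1 0) : ℝ) := by
  have hQ := hN.contDiffOn hT hUT hτ hχ hσ hζ
  rw [baseCLM_apply, fderiv_base_comp (differentiableAt_of_contDiffOn hU hQ hz)]
  have hev : (fun z => (Q z).1 0) =ᶠ[nhds z] fun z => τ (z.1 0) :=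
    Filter.eventuallyEq_of_mem (hU.mem_nhds hz) fun z hz => by simp [hN z hz]
  rw [hev.fderiv_eq, fderiv_comp_time hT hU hUT hτ hz, smul_eq_mul]

theorem HasNormalForm.fderiv_space {z : Base n × ℂ} (hz : z ∈ U) (v : Base n × ℂ) (a : Fin n) :
    baseCLM a.succ (fderiv ℝ Q z v) = (1 / 2 * iteratedDeriv 2 τ (z.1 0) * v.1 0 * z.1 a.succ +
        1 / 2 * deriv τ (z.1 0) * v.1 a.succ + ∑ b : Fin n, κ a b * v.1 b.succ +
        deriv (χ a) (z.1 0) * v.1 0 : ℝ) := by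
  have hQ := hN.contDiffOn hT hUT hτ hχ hσ hζ
  rw [baseCLM_apply, fderiv_base_comp (differentiableAt_of_contDiffOn hU hQ hz)]
  have hev : (fun z => (Q z).1 a.succ) =ᶠ[nhds z] spaceComp τ κ χ a :=
    Filter.eventuallyEq_of_mem (hU.mem_nhds hz) fun z hz => by simp [hN z hz]
  rw [hev.fderiv_eq, fderiv_spaceComp hT hU hUT hτ κ hχ a hz]

theorem HasNormalForm.fderiv_psi {z : Base n × ℂ} (hz : z ∈ U) (w : ℂ) :
    (fderiv ℝ Q z (0, w)).2 = w * (phaseComp τ χ σ z * Complex.I + ζ (z.1 0)) := by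
  have hQ := hN.contDiffOn hT hUT hτ hχ hσ hζ
  rw [fderiv_psi_comp (differentiableAt_of_contDiffOn hU hQ hz)]
  have hev : (fun z => (Q z).2) =ᶠ[nhds z]
      fun z => (phaseComp τ χ σ z * Complex.I + ζ (z.1 0)) * z.2 :=
    Filter.eventuallyEq_of_mem (hU.mem_nhds hz) fun z hz => by simp [hN z hz]
  have h1 := (differentiableAt_of_contDiffOn hU
    (contDiffOn_psiFactor hT hUT hτ hχ hσ hζ) hz).hasFDerivAt.mul
    (ContinuousLinearMap.snd ℝ (Base n) ℂ).hasFDerivAt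
  have h2 := h1.fderiv
  rw [hev.fderiv_eq]
  refine (congrArg (fun L => L (0, w)) h2).trans ?_
  simp only [_root_.add_apply, _root_.smul_apply, ContinuousLinearMap.coe_snd', smul_eq_mul,
    fderiv_psiFactor hT hU hUT hτ hχ hσ hζ hz, fderiv_phaseComp hT hU hUT hτ hχ hσ hz,
    Pi.zero_apply, mul_zero, zero_mul, Finset.sum_const_zero, add_zero, Complex.ofReal_zero]
  ring

theorem HasNormalForm.psiCoeff_eq {z : Base n × ℂ} (hz : z ∈ U) :
    psiCoeff Q z = phaseComp τ χ σ z * Complex.I + ζ (z.1 0) := by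
  rw [psiCoeff, hN.fderiv_psi hT hU hUT hτ hχ hσ hζ hz, one_mul]

theorem HasNormalForm.fderiv_psiCoeff {z : Base n × ℂ} (hz : z ∈ U) (v : Base n × ℂ) :
    fderiv ℝ (psiCoeff Q) z v =
      (fderiv ℝ (phaseComp τ χ σ) z v : ℝ) * Complex.I + (v.1 0 * deriv ζ (z.1 0) : ℝ) := by
  have hev : psiCoeff Q =ᶠ[nhds z] fun z => (phaseComp τ χ σ z * Complex.I + ζ (z.1 0) : ℂ) :=
    Filter.eventuallyEq_of_mem (hU.mem_nhds hz) fun z hz =>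
      hN.psiCoeff_eq hT hU hUT hτ hχ hσ hζ hz
  rw [hev.fderiv_eq, fderiv_psiFactor hT hU hUT hτ hχ hσ hζ hz]

theorem HasNormalForm.inhomPart_eq_zero {z : Base n × ℂ} (hz : z ∈ U) : inhomPart Q z = 0 := by
  rw [inhomPart, hN.psiCoeff_eq hT hU hUT hτ hχ hσ hζ hz, hN z hz]
  simp

theorem HasNormalForm.sndDeriv_time {z : Base n × ℂ} (hz : z ∈ U) :
    baseCLM 0 (fderiv ℝ (fderiv ℝ Q) z (Pi.single 0 1, 0) (Pi.single 0 1, 0)) =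
      (iteratedDeriv 2 τ (z.1 0) : ℝ) := by
  have hQ := hN.contDiffOn hT hUT hτ hχ hσ hζ
  rw [← fderiv_clm_fderiv hU hQ _ hz]
  have hev : (fun z => baseCLM 0 (fderiv ℝ Q z (Pi.single 0 1, 0))) =ᶠ[nhds z]
      fun z => ((fun t => ((deriv τ t : ℝ) : ℂ)) (z.1 0)) :=
    Filter.eventuallyEq_of_mem (hU.mem_nhds hz) fun z hz => by
      simp [hN.fderiv_time hT hU hUT hτ hχ hσ hζ hz]
  have hd := contDiffOn_deriv_infty hT hτ
  rw [hev.fderiv_eq, fderiv_comp_time hT hU hUT (φ := fun t => ((deriv τ t : ℝ) : ℂ))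
    (Complex.ofRealCLM.contDiff.comp_contDiffOn hd) hz]
  have h := (Complex.ofRealCLM.hasFDerivAt.comp_hasDerivAt _
    (differentiableAt_of_contDiffOn hT hd (hUT z hz)).hasDerivAt).deriv
  simp only [Pi.single_eq_same, one_smul, iteratedDeriv_two_eq]
  exact h

theorem HasNormalForm.firstOrderEqs (hκ : κ.transpose = -κ) : FirstOrderEqs U Q := by
  have hk : ∀ a b, κ b a = -κ a b := fun a b => congrFun (congrFun hκ a) b
  refine ⟨fun z hz a => ?_, fun z hz l w => ?_, fun z hz a b => ?_, fun z hz w => ?_⟩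
  · rw [hN.fderiv_time hT hU hUT hτ hχ hσ hζ hz]
    simp
  · refine Fin.cases ?_ (fun a => ?_) l
    · rw [hN.fderiv_time hT hU hUT hτ hχ hσ hζ hz]
      simp
    · rw [hN.fderiv_space hT hU hUT hτ hχ hσ hζ hz]
      simp
  · rw [hN.fderiv_time hT hU hUT hτ hχ hσ hζ hz, hN.fderiv_space hT hU hUT hτ hχ hσ hζ hz,
      hN.fderiv_space hT hU hUT hτ hχ hσ hζ hz]
    have h1 : ∀ a b : Fin n, ∑ c : Fin n, κ b c * (Pi.single a.succ 1 : Base n) c.succ = κ b a := by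
      intro a b
      simp [Pi.single_apply]
    rw [h1, h1, hk b a]
    split_ifs with hab
    · subst hab
      simp
      ring
    · simp [hab, Ne.symm hab]
  · rw [hN.fderiv_psi hT hU hUT hτ hχ hσ hζ hz, hN.fderiv_psi hT hU hUT hτ hχ hσ hζ hz, one_mul]

theorem HasNormalForm.secondOrderEqs : SecondOrderEqs U Q := by
  have hQ := hN.contDiffOn hT hUT hτ hχ hσ hζ
  refine ⟨fun z hz => ?_, fun z hz a => ?_⟩
  · rw [← NLSym.fderiv_psiCoeff hU hQ hz, hN.fderiv_psiCoeff hT hU hUT hτ hχ hσ hζ hz,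
      fderiv_phaseComp hT hU hUT hτ hχ hσ hz]
    simp
  · rw [← NLSym.fderiv_psiCoeff hU hQ hz, hN.fderiv_psiCoeff hT hU hUT hτ hχ hσ hζ hz,
      fderiv_phaseComp hT hU hUT hτ hχ hσ hz, hN.fderiv_space hT hU hUT hτ hχ hσ hζ hz]
    simp [Pi.single_apply]
    ring

theorem HasNormalForm.zeroOrderLinear_eq_zero_iff (S : Base n × ℝ → ℂ) {z : Base n × ℂ}
    (hz : z ∈ U) :
    zeroOrderLinear S Q z = 0 ↔ ClassifyingCondition S τ κ χ σ ζ (z.1, ‖z.2‖) := by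
  have hS : fderiv ℝ S (z.1, ‖z.2‖) ((Q z).1, 0) = (τ (z.1 0) : ℂ) * dBase S 0 (z.1, ‖z.2‖) +
      ∑ a : Fin n, (spaceComp τ κ χ a z : ℂ) * dBase S a.succ (z.1, ‖z.2‖) := by
    have hv : (((Q z).1, 0) : Base n × ℝ) = ∑ l, (Q z).1 l • (Pi.single l 1, 0) := by
      refine Prod.ext ?_ (by simp [Prod.snd_sum])
      ext i
      simp [Prod.fst_sum, Finset.sum_apply, Pi.single_apply]
    rw [hv, map_sum, Fin.sum_univ_succ]
    simp only [map_smul, hN z hz, Fin.cons_zero, Fin.cons_succ, Complex.real_smul, dBase]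
  rw [zeroOrderLinear, hS, hN.fderiv_psiCoeff hT hU hUT hτ hχ hσ hζ hz,
    fderiv_phaseComp hT hU hUT hτ hχ hσ hz, hN.fderiv_time hT hU hUT hτ hχ hσ hζ hz,
    hN.sndDeriv_time hT hU hUT hτ hχ hσ hζ hz, hN.psiCoeff_eq hT hU hUT hτ hχ hσ hζ hz,
    ClassifyingCondition]
  simp only [spaceComp]
  rw [← sub_eq_zero (b := (_ - _ - _ : ℂ))]
  refine Eq.congr ?_ rfl
  simp
  ring_nf
  simp only [Complex.I_sq]
  ring

end FromNormalForm

variable {D : Set (Base n × ℝ)} {S : Base n × ℝ → ℂ} {Q : VField n}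

/-- In the normal form η is a multiple of ψ, so η⁰ vanishes with all its derivatives, and of the
zero-order part only L remains. -/
theorem mem_algebra_of_normalForm (hn : 1 ≤ n) (hD : IsAdmissibleDomain D) (hS : IsClassS D S)
    {τ : ℝ → ℝ} {κ : Matrix (Fin n) (Fin n) ℝ} {χ : Fin n → ℝ → ℝ} {σ ζ : ℝ → ℝ}
    (hτ : ContDiffOn ℝ ∞ τ (timeSet D)) (hχ : ∀ a, ContDiffOn ℝ ∞ (χ a) (timeSet D))
    (hσ : ContDiffOn ℝ ∞ σ (timeSet D)) (hζ : ContDiffOn ℝ ∞ ζ (timeSet D))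
    (hκ : κ.transpose = -κ) (hC : ∀ p ∈ D, ClassifyingCondition S τ κ χ σ ζ p)
    (hN : HasNormalForm (pointSpace D) Q τ κ χ σ ζ) : Q ∈ maximalLieInvarianceAlgebra D S := by
  have hT := hD.isOpen_timeSet
  have hU := hD.isOpen_pointSpace
  have hUT : ∀ z ∈ pointSpace D, z.1 0 ∈ timeSet D := fun z hz => mem_timeSet hz
  have hQ := hN.contDiffOn hT hUT hτ hχ hσ hζ
  rw [mem_maximalLieInvarianceAlgebra_iff hD hS]
  have hF := hN.firstOrderEqs hT hU hUT hτ hχ hσ hζ hκ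
  have hG := hN.secondOrderEqs hT hU hUT hτ hχ hσ hζ
  refine ⟨hQ, (criterion_iff_determiningEqs hn hU hQ).2 ⟨hF, hG, fun z hz => ?_⟩⟩
  have hg : ∀ z ∈ pointSpace D, inhomPart Q z = 0 := fun z hz =>
    hN.inhomPart_eq_zero hT hU hUT hτ hχ hσ hζ hz
  have hev : inhomPart Q =ᶠ[nhds z] fun _ => 0 := Filter.eventuallyEq_of_mem (hU.mem_nhds hz) hg
  have hgd : fderiv ℝ (inhomPart Q) =ᶠ[nhds z] fun _ => 0 := by
    filter_upwards [hev.fderiv (𝕜 := ℝ)] with y hy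
    simpa using hy
  have hL : zeroOrderLinear S Q z = 0 :=
    (hN.zeroOrderLinear_eq_zero_iff hT hU hUT hτ hχ hσ hζ S hz).2 (hC _ hz)
  rw [zeroOrderPart_eq hU hQ hF hG S hz (hD.ne_zero hz), hL, zeroOrderConst, hg z hz,
    hgd.fderiv_eq, hgd.eq_of_nhds]
  simp

section ToNormalForm

variable (hD : IsAdmissibleDomain D) (hQ : ContDiffOn ℝ ∞ Q (pointSpace D))
  (hF : FirstOrderEqs (pointSpace D) Q) (hG : SecondOrderEqs (pointSpace D) Q)
include hD hQ hF

theorem exists_time :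
    ∃ τ : ℝ → ℝ, ContDiffOn ℝ ∞ τ (timeSet D) ∧ ∀ z ∈ pointSpace D, (Q z).1 0 = τ (z.1 0) := by
  have hd := fun z hz => differentiableAt_of_contDiffOn hD.isOpen_pointSpace hQ (z := z) hz
  refine hD.exists_factorization (f := fun z => (Q z).1 0) (contDiffOn_pi.1 hQ.fst 0) ?_ ?_
  · intro z hz a
    rw [← fderiv_base_comp (hd z hz)]
    simpa [baseCLM_apply] using hF.time z hz a
  · intro z hz w
    rw [← fderiv_base_comp (hd z hz)]
    simpa [baseCLM_apply] using hF.psi z hz 0 w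

include hG

/-- The skew-symmetric part of the gradient of `ξ` is constant. -/
theorem exists_rotation : ∃ κ : Matrix (Fin n) (Fin n) ℝ, κ.transpose = -κ ∧
    ∀ z ∈ pointSpace D, ∀ a b : Fin n, (fderiv ℝ Q z (Pi.single b.succ 1, 0)).1 a.succ =
      κ a b + if a = b then 1 / 2 * (fderiv ℝ Q z (Pi.single 0 1, 0)).1 0 else 0 := by
  have hU := hD.isOpen_pointSpace
  have hH := contDiffOn_psiCoeff hU hQ
  let L : Fin n → Fin n → (Base n × ℂ →L[ℝ] Base n × ℂ) →L[ℝ] ℂ := fun a b =>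
    (baseCLM a.succ).comp (ContinuousLinearMap.apply ℝ (Base n × ℂ) (Pi.single b.succ 1, 0)) -
      if a = b then (1 / 2 : ℂ) • (baseCLM 0).comp
        (ContinuousLinearMap.apply ℝ (Base n × ℂ) (Pi.single 0 1, 0)) else 0
  have hL : ∀ a b T, L a b T = baseCLM a.succ (T (Pi.single b.succ 1, 0)) -
      if a = b then (1 / 2 : ℂ) * baseCLM 0 (T (Pi.single 0 1, 0)) else 0 := by
    intro a b T
    by_cases hab : a = b <;> simp [L, hab]
  have hzero : ∀ a b, ∀ z ∈ pointSpace D, ∀ u, L a b (fderiv ℝ (fderiv ℝ Q) z u) = 0 := by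
    rintro a b z hz ⟨v, w⟩
    -- The time direction is where `SecondOrderEqs` enters: ξ^a_{tb} is proportional to the Hessian
    -- of η_ψ, hence symmetric, so it equals its Killing part δ_{ab}τ_{tt}/2.
    have h0 : L a b (fderiv ℝ (fderiv ℝ Q) z (Pi.single 0 1, 0)) = 0 := by
      have h1 := hF.snd_killing hU hQ hz (Pi.single 0 1, 0) a b
      have h2 : baseCLM b.succ (fderiv ℝ (fderiv ℝ Q) z (Pi.single 0 1, 0) (Pi.single a.succ 1, 0)) =
          baseCLM a.succ
            (fderiv ℝ (fderiv ℝ Q) z (Pi.single 0 1, 0) (Pi.single b.succ 1, 0)) := by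
        have h3 := sndDeriv_comm hU hH hz (Pi.single a.succ 1, 0) (Pi.single b.succ 1, 0)
        rw [sndDeriv_psiCoeff hU hQ hG hz, sndDeriv_psiCoeff hU hQ hG hz] at h3
        rw [sndDeriv_comm hU hQ hz, sndDeriv_comm hU hQ hz (Pi.single 0 1, 0)]
        exact mul_left_cancel₀ (by simp) h3
      rw [h2] at h1
      rw [hL]
      split_ifs at h1 ⊢ <;> linear_combination (1 / 2 : ℂ) * h1
    have hx : ∀ c : Fin n, L a b (fderiv ℝ (fderiv ℝ Q) z (Pi.single c.succ 1, 0)) = 0 := by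
      intro c
      rw [hL, hF.snd_space hU hQ hz, sndDeriv_comm hU hQ hz, hF.snd_time hU hQ hz]
      simp
    have hψ : L a b (fderiv ℝ (fderiv ℝ Q) z (0, w)) = 0 := by
      rw [hL, sndDeriv_comm hU hQ hz, hF.snd_psi hU hQ hz, sndDeriv_comm hU hQ hz,
        hF.snd_psi hU hQ hz]
      simp
    rw [clm_apply_eq_sum, map_add, map_add, map_sum]
    simp only [map_smul, h0, hx, hψ, smul_zero, Finset.sum_const_zero, add_zero]
  have hder : ∀ a b, ∀ z ∈ pointSpace D,
      HasFDerivAt (fun z => L a b (fderiv ℝ Q z)) (0 : Base n × ℂ →L[ℝ] ℂ) z := by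
    intro a b z hz
    have h := (L a b).hasFDerivAt.comp z (differentiableAt_fderiv hU hQ hz).hasFDerivAt
    rwa [show (L a b).comp (fderiv ℝ (fderiv ℝ Q) z) = 0 from
      ContinuousLinearMap.ext (hzero a b z hz)] at h
  obtain ⟨p₀, hp₀⟩ := hD.isConnected.nonempty
  have hz₀ := hD.ofReal_mem hp₀
  set z₀ : Base n × ℂ := (p₀.1, (p₀.2 : ℂ))
  -- Connectedness of the whole domain, not only of its slices, yields one κ for all times.
  have hconst : ∀ a b, ∀ z ∈ pointSpace D, L a b (fderiv ℝ Q z) = L a b (fderiv ℝ Q z₀) :=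
    fun a b z hz => hU.is_const_of_fderiv_eq_zero hD.isPreconnected_pointSpace
      (fun z hz => (hder a b z hz).differentiableAt.differentiableWithinAt)
      (fun z hz => (hder a b z hz).fderiv) hz hz₀
  have hre : ∀ a b z, L a b (fderiv ℝ Q z) = (((fderiv ℝ Q z (Pi.single b.succ 1, 0)).1 a.succ -
      if a = b then 1 / 2 * (fderiv ℝ Q z (Pi.single 0 1, 0)).1 0 else 0 : ℝ) : ℂ) := by
    intro a b z
    rw [hL]
    split_ifs <;> simp [baseCLM_apply]
  refine ⟨Matrix.of fun a b => (fderiv ℝ Q z₀ (Pi.single b.succ 1, 0)).1 a.succ -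
      if a = b then 1 / 2 * (fderiv ℝ Q z₀ (Pi.single 0 1, 0)).1 0 else 0, ?_, ?_⟩
  · ext a b
    have h := hF.killing z₀ hz₀ a b
    simp only [baseCLM_apply] at h
    simp only [Matrix.transpose_apply, Matrix.neg_apply, Matrix.of_apply]
    by_cases hab : a = b
    · subst hab
      rw [if_pos rfl] at h ⊢
      norm_cast at h
      linarith
    · rw [if_neg hab] at h ⊢
      rw [if_neg (Ne.symm hab)]
      norm_cast at h
      linarith
  · intro z hz a b
    have h := hconst a b z hz
    rw [hre, hre, Complex.ofReal_inj] at h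
    rw [Matrix.of_apply]
    linarith

theorem exists_normalForm (hg : ∀ z ∈ pointSpace D, inhomPart Q z = 0) :
    ∃ (τ : ℝ → ℝ) (κ : Matrix (Fin n) (Fin n) ℝ) (χ : Fin n → ℝ → ℝ) (σ ζ : ℝ → ℝ),
      ContDiffOn ℝ ∞ τ (timeSet D) ∧ (∀ a, ContDiffOn ℝ ∞ (χ a) (timeSet D)) ∧
      ContDiffOn ℝ ∞ σ (timeSet D) ∧ ContDiffOn ℝ ∞ ζ (timeSet D) ∧ κ.transpose = -κ ∧
      HasNormalForm (pointSpace D) Q τ κ χ σ ζ := by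
  have hU := hD.isOpen_pointSpace
  have hT := hD.isOpen_timeSet
  have hUT : ∀ z ∈ pointSpace D, z.1 0 ∈ timeSet D := fun z hz => mem_timeSet hz
  have hd := fun z hz => differentiableAt_of_contDiffOn hU hQ (z := z) hz
  have hH := contDiffOn_psiCoeff hU hQ
  obtain ⟨τ, hτ, hτQ⟩ := exists_time hD hQ hF
  obtain ⟨κ, hκ, hκQ⟩ := exists_rotation hD hQ hF hG
  have hτd : ∀ z ∈ pointSpace D, (fderiv ℝ Q z (Pi.single 0 1, 0)).1 0 = deriv τ (z.1 0) := by
    intro z hz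
    have hev : (fun z => (Q z).1 0) =ᶠ[nhds z] fun z => τ (z.1 0) :=
      Filter.eventuallyEq_of_mem (hU.mem_nhds hz) hτQ
    rw [fderiv_base_comp (hd z hz), hev.fderiv_eq, fderiv_comp_time hT hU hUT hτ hz]
    simp
  -- Removing the part of ξ^a linear in x leaves a function with zero x- and ψ-derivatives, which
  -- descends to t because the slices are connected.
  have hχex : ∀ a : Fin n, ∃ χ : ℝ → ℝ, ContDiffOn ℝ ∞ χ (timeSet D) ∧
      ∀ z ∈ pointSpace D, (Q z).1 a.succ - spaceComp τ κ 0 a z = χ (z.1 0) := by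
    intro a
    have hc0 : ∀ a : Fin n, ContDiffOn ℝ ∞ ((0 : Fin n → ℝ → ℝ) a) (timeSet D) :=
      fun a => contDiffOn_const
    have hsp := contDiffOn_spaceComp hT hUT hτ κ hc0 a
    have hfd : ∀ z ∈ pointSpace D, ∀ v, fderiv ℝ (fun z => (Q z).1 a.succ - spaceComp τ κ 0 a z) z v
        = (fderiv ℝ Q z v).1 a.succ - fderiv ℝ (spaceComp τ κ 0 a) z v := by
      intro z hz v
      have hq : DifferentiableAt ℝ (fun z => (Q z).1 a.succ) z :=
        differentiableAt_of_contDiffOn hU (contDiffOn_pi.1 hQ.fst a.succ) hz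
      rw [fderiv_fun_sub hq (differentiableAt_of_contDiffOn hU hsp hz), fderiv_base_comp (hd z hz)]
      rfl
    refine hD.exists_factorization ((contDiffOn_pi.1 hQ.fst a.succ).sub hsp) ?_ ?_
    · intro z hz c
      rw [hfd z hz, fderiv_spaceComp hT hU hUT hτ κ hc0 a hz, hκQ z hz, hτd z hz]
      simp [Pi.single_apply, add_comm]
    · intro z hz w
      rw [hfd z hz, fderiv_spaceComp hT hU hUT hτ κ hc0 a hz]
      have := hF.psi z hz a.succ w
      rw [baseCLM_apply, Complex.ofReal_eq_zero] at this
      simp [this]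
  choose χ hχ hχQ using hχex
  have hξ : ∀ a, ∀ z ∈ pointSpace D, (Q z).1 a.succ = spaceComp τ κ χ a z := by
    intro a z hz
    have := hχQ a z hz
    simp only [spaceComp, Pi.zero_apply] at this ⊢
    linarith
  have hξt : ∀ a, ∀ z ∈ pointSpace D, baseCLM a.succ (fderiv ℝ Q z (Pi.single 0 1, 0)) =
      (1 / 2 * iteratedDeriv 2 τ (z.1 0) * z.1 a.succ + deriv (χ a) (z.1 0) : ℝ) := by
    intro a z hz
    have hev : (fun z => (Q z).1 a.succ) =ᶠ[nhds z] spaceComp τ κ χ a :=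
      Filter.eventuallyEq_of_mem (hU.mem_nhds hz) (hξ a)
    rw [baseCLM_apply, fderiv_base_comp (hd z hz), hev.fderiv_eq,
      fderiv_spaceComp hT hU hUT hτ κ hχ a hz]
    simp
  have hc0 : ContDiffOn ℝ ∞ (0 : ℝ → ℝ) (timeSet D) := contDiffOn_const
  have hpf := contDiffOn_psiFactor hT hUT hτ hχ hc0 hc0
  -- The same for η_ψ. Its x-gradient iξ_t/2 is purely imaginary, so x enters only the phase; the
  -- remainder φ(t) supplies σ as imaginary part and ζ as real part.
  obtain ⟨φ, hφ, hφQ⟩ : ∃ φ : ℝ → ℂ, ContDiffOn ℝ ∞ φ (timeSet D) ∧ ∀ z ∈ pointSpace D,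
      psiCoeff Q z - (phaseComp τ χ 0 z * Complex.I + ((0 : ℝ → ℝ) (z.1 0) : ℝ)) = φ (z.1 0) := by
    have hfd : ∀ z ∈ pointSpace D, ∀ v, fderiv ℝ (fun z => psiCoeff Q z -
        (phaseComp τ χ 0 z * Complex.I + ((0 : ℝ → ℝ) (z.1 0) : ℝ))) z v
        = fderiv ℝ (psiCoeff Q) z v - (fderiv ℝ (phaseComp τ χ 0) z v : ℝ) * Complex.I := by
      intro z hz v
      rw [fderiv_fun_sub (differentiableAt_of_contDiffOn hU hH hz)
        (differentiableAt_of_contDiffOn hU hpf hz), _root_.sub_apply,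
        fderiv_psiFactor hT hU hUT hτ hχ hc0 hc0 hz]
      simp [show deriv (0 : ℝ → ℝ) = 0 by ext; simp [Pi.zero_def]]
    refine hD.exists_factorization (hH.sub hpf) ?_ ?_
    · intro z hz a
      rw [hfd z hz, fderiv_psiCoeff_space hU hQ hG hz, fderiv_phaseComp hT hU hUT hτ hχ hc0 hz,
        hξt a z hz]
      simp [Pi.single_apply]
      ring
    · intro z hz w
      rw [hfd z hz, fderiv_psiCoeff_psi hU hQ hF hG hz, fderiv_phaseComp hT hU hUT hτ hχ hc0 hz]
      simp
  refine ⟨τ, κ, χ, fun t => (φ t).im, fun t => (φ t).re, hτ, hχ,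
    Complex.imCLM.contDiff.comp_contDiffOn hφ, Complex.reCLM.contDiff.comp_contDiffOn hφ, hκ, ?_⟩
  intro z hz
  refine Prod.ext (funext fun l => Fin.cases (hτQ z hz) (fun a => hξ a z hz) l) ?_
  have h1 := hg z hz
  rw [inhomPart, sub_eq_zero] at h1
  have h2 := hφQ z hz
  rw [h1]
  congr 1
  rw [sub_eq_iff_eq_add'] at h2
  rw [h2]
  simp [phaseComp]
  linear_combination -Complex.re_add_im (φ (z.1 0))

end ToNormalForm

end Classification

end NLSym

end

theorem mainTheorem5 (n : ℕ) (hn : 1 ≤ n)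
    (D : Set (NLSym.Base n × ℝ)) (hD : NLSym.IsAdmissibleDomain D)
    (S : NLSym.Base n × ℝ → ℂ) (hS : NLSym.IsClassS D S) (Q : NLSym.VField n) :
    Q ∈ NLSym.maximalLieInvarianceAlgebra D S ↔
      ∃ (τ : ℝ → ℝ) (κ : Matrix (Fin n) (Fin n) ℝ) (χ : Fin n → ℝ → ℝ) (σ ζ : ℝ → ℝ),
        ContDiffOn ℝ ∞ τ (NLSym.timeSet D) ∧
        (∀ a, ContDiffOn ℝ ∞ (χ a) (NLSym.timeSet D)) ∧
        ContDiffOn ℝ ∞ σ (NLSym.timeSet D) ∧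
        ContDiffOn ℝ ∞ ζ (NLSym.timeSet D) ∧
        κ.transpose = -κ ∧
        (∀ p ∈ D, NLSym.ClassifyingCondition S τ κ χ σ ζ p) ∧
        Set.EqOn Q (NLSym.generalField τ κ χ σ ζ) (NLSym.pointSpace D) := by
  constructor
  · intro hmem
    obtain ⟨hQ, hcrit⟩ := (NLSym.mem_maximalLieInvarianceAlgebra_iff hD hS).1 hmem
    have hU := hD.isOpen_pointSpace
    have hUT : ∀ z ∈ NLSym.pointSpace D, z.1 0 ∈ NLSym.timeSet D :=
      fun z hz => NLSym.mem_timeSet hz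
    obtain ⟨hF, hG, h0⟩ := (NLSym.criterion_iff_determiningEqs hn hU hQ).1 hcrit
    obtain ⟨τ, κ, χ, σ, ζ, hτ, hχ, hσ, hζ, hκ, hN⟩ := NLSym.exists_normalForm hD hQ hF hG
      fun z hz => NLSym.inhomPart_eq_zero hD hQ hF hG hS h0 hz
    refine ⟨τ, κ, χ, σ, ζ, hτ, hχ, hσ, hζ, hκ, fun p hp => ?_, fun z hz => ?_⟩
    -- L = 0 is an identity over (t, x, ψ); taking ψ = ρ > 0 turns it into the condition at (t, x,
    -- ρ).
    · have hz := hD.ofReal_mem hp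
      have h := (hN.zeroOrderLinear_eq_zero_iff hD.isOpen_timeSet hU hUT hτ hχ hσ hζ S hz).1
        (NLSym.zeroOrder_split hD hQ hF hG h0 hz).1
      rwa [Complex.norm_real, Real.norm_of_nonneg (hD.rho_pos p hp).le] at h
    · rw [hN z hz, NLSym.generalField_eq τ hκ]
  · rintro ⟨τ, κ, χ, σ, ζ, hτ, hχ, hσ, hζ, hκ, hC, hE⟩
    exact NLSym.mem_algebra_of_normalForm hn hD hS hτ hχ hσ hζ hκ hC fun z hz => by
      rw [hE hz, NLSym.generalField_eq τ hκ]
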